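/- Let $H\neq\{0\}$ and $G$ be (real or complex) Hilbert spaces, with norm $|\cdot|$ and scalar product $\langle\cdot,\cdot\rangle$ on $H$ (in the complex case read $\operatorname{Re}\langle\cdot,\cdot\rangle$ throughout). (A1) Let $A:D(A)\subset H\to H$ be self-adjoint and positive, with compact resolvent and $|Au|\ge\omega|u|$ on $D(A)$ for some $\omega>0$. Put $H_k=D(A^{k/2})$ with norm $|A^{k/2}\cdot|$, $H_0=H$, and for a pair $W=(w,w')$ put $e_k(W)=\frac12\big(|A^{k/2}w|^2+|A^{(k-1)/2}w'|^2\big)$. Solutions of $w''+Aw=f$ with $(w,w')(0)\in H_1\times H$ and $f\in L^2([0,T];H)$ are mild solutions, $(w,w')\in C([0,T];H_1\times H)$. (A2) Let $C\in\mathcal L(H)$ with $C^*\in\mathcal L(H_1)$, $\|C\|=\beta$ and $|Cw|^2\le\beta\langle Cw,w\rangle$ for all $w\in H$; let $\Pi\in\mathcal L(H)$ and $\alpha>0$ satisfy $\alpha|\Pi w|^2\le\langle Cw,w\rangle$ for all $w\in H$. (A3) There is $T_0>0$ such that for every $T>T_0$ there is $C_2(T)>0$ with $\int_0^T|\Pi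 w'|^2dt\ge C_2(T)\,e_1(W)(0)$ for all solutions of $w''+Aw=0$ with data in $H_1\times H$. (A4) $\mathbf B^*\in\mathcal L(H_2\times H;G)$, and for every $T>0$ there is $c>0$ such that for all solutions of $w''+Aw=f$ with data in $H_1\times H$ and $f\in L^2([0,T];H)$ one has $\mathbf B^*(w,w')\in L^2([0,T];G)$ and $$\int_0^T\|\mathbf B^*(w,w')\|_G^2dt\le c\Big(e_1(W)(0)+e_1(W)(T)+\int_0^Te_1(W)\,dt+\int_0^T|f|^2dt\Big).$$ (For solutions that take values only in $H_1\times H$, $\mathbf B^*(w,w')$ denotes the extension by continuity from regular solutions; equivalently, it is the time derivative of $t\mapsto\mathbf B^*\big(\int_0^tw,\int_0^tw'\big)$, where $\int_0^t w\in D(A)$.) (A5) For the same $T_0$ and every $T>T_0$ there is $C_1(T)>0$ with $\int_0^T\|\mathbf B^*(w,w')\|_G^2dt\ge C_1(T)\,e_1(W)(0)$ for all solutions of $w''+Aw=0$ with data in $H_1\times H$. **Theorem.** Assume (A1)–(A5). (a) For every $\tau>T_0$ there are constants $\eta_0,\alpha_0,\gamma_0>0$ such that, for all $T>\tau$, $$\int_0^Te_1(P)\,dt-\alpha_0\int_0^T|f|^2dt\le\eta_0\int_0^T\|\mathbf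 B^*P\|_G^2dt\quad\text{and}\quad T\,e_1(V)(0)\le\gamma_0\int_0^T|\Pi v'|^2dt \tag{1}$$ for all solutions $P=(p,p')$ of $p''+Ap=f\in L^2([0,T];H)$ and $V=(v,v')$ of $v''+Av=0$. (b) Let $\tau>0$ and let $\eta_0,\alpha_0,\gamma_0>0$ be any constants such that (1) holds for all $T>\tau$. With $c_3=32$, $c_4=128$, put $a=\frac{c_3\beta\gamma_0}{2\alpha}$, $b=\frac{c_4\beta^2\gamma_0^2}{2\alpha^2}$, $s=\sqrt{a^2+a+b}$, $M=\frac{s}{(2a+1)(a+s)+a+2b}$, $\kappa=\frac{c_3}{M}+\frac{c_4\beta\gamma_0}{\alpha}$, $$T_1=\frac{\sqrt{2c_4\alpha_0}\,\beta\gamma_0}{\alpha},\qquad T_2=\sqrt{\frac{2c_3\alpha_0\beta\gamma_0}{\alpha M}},\qquad T_3=\max(\tau,T_1,T_2)>0 .$$ Then for all $T>T_3$ and all initial data $(u_1^0,u_2^0,u_1^1,u_2^1)\in H_1^2\times H^2$, the solution of $u_1''+Au_1=0$, $u_2''+Au_2+Cu_1=0$, $(u_i,u_i')(0)=(u_i^0,u_i^1)$,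 with $U_i=(u_i,u_i')$, satisfies $\mathbf B^*U_2\in L^2([0,T];G)$ and $$e_0(U_1)(0)\le d_1(T)\int_0^T\|\mathbf B^*U_2\|_G^2,\qquad e_1(U_2)(0)\le d_2(T)\int_0^T\|\mathbf B^*U_2\|_G^2,$$ $$\int_0^Te_1(U_2)\le k_2(T)\int_0^T\|\mathbf B^*U_2\|_G^2,\qquad \int_0^T\langle Cu_1,u_1\rangle\le r_2(T)\int_0^T\|\mathbf B^*U_2\|_G^2,$$ where $$d_1(T)=\frac{2\eta_0\gamma_0^2\kappa}{\alpha^2(T^2-T_2^2)T}>0,\quad d_2(T)=\frac{2\eta_0T}{M(T^2-T_2^2)}>0,\quad k_2(T)=\frac{2\eta_0T^2}{T^2-T_2^2},\quad r_2(T)=\frac{2\eta_0\gamma_0\kappa}{\alpha(T^2-T_2^2)} .$$ Moreover, with $K=4\eta_0\big(1+\frac1M+\big(\frac{\gamma_0}{\alpha}+\frac{\gamma_0^2}{\alpha^2}\big)\kappa\big)>0$, which does not depend on $T$, one has for all $T>T_3$ with $T\ge\sqrt2\,T_2$ $$d_1(T)\le\frac K{T^3},\quad d_2(T)\le\frac KT,\quad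 k_2(T)\le K,\quad r_2(T)\le\frac K{T^2}.$$ (c) If $C$ itself satisfies (A3), then one can choose $\Pi=C$: the inequality $\alpha|\Pi w|^2\le\langle Cw,w\rangle$ of (A2) holds with $\Pi=C$ and $\alpha=\beta^{-1}$, and (a), (b) hold with this choice. -/

import Mathlib

open MeasureTheory Filter Topology
open scoped ENNReal NNReal InnerProductSpace

noncomputable section

namespace Cascade

section Operators

variable {𝕜 H : Type*} [RCLike 𝕜] [NormedAddCommGroup H] [InnerProductSpace 𝕜 H]
  [CompleteSpace H]

/-- `A` has a compact resolvent: for some `μ` in the resolvent set, the (two-sided) inverse of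
`A - μ` is a compact operator on `H`. -/
def HasCompactResolvent (A : H →ₗ.[𝕜] H) : Prop :=
  ∃ (μ : 𝕜) (R : H →L[𝕜] H), IsCompactOperator R ∧
    (∀ x : H, ∃ h : R x ∈ A.domain, A ⟨R x, h⟩ - μ • R x = x) ∧
    ∀ u : A.domain, R (A u - μ • (u : H)) = u

/-- The standing hypothesis on `A`: self-adjoint, positive (so that its fractional powers make
sense), `|A u| ≥ ω |u|` for some `ω > 0`, and with compact resolvent. -/
structure IsAdmissibleGenerator (A : H →ₗ.[𝕜] H) : Prop where
  selfAdjoint : IsSelfAdjoint A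
  positive : ∀ u : A.domain, 0 ≤ RCLike.re ⟪A u, (u : H)⟫_𝕜
  bounded_below : ∃ ω : ℝ, 0 < ω ∧ ∀ u : A.domain, ω * ‖(u : H)‖ ≤ ‖A u‖
  compact_resolvent : HasCompactResolvent A

/-- The eigenspace `{u ∈ D(A) : A u = μ u}` of an unbounded operator. -/
def eigenspace (A : H →ₗ.[𝕜] H) (μ : ℝ) : Submodule 𝕜 H :=
  A.graph.comap (LinearMap.prod LinearMap.id ((μ : 𝕜) • LinearMap.id))

/-- The spectral projection of `A` at `μ`. (The eigenspaces of a closed operator are closed; the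
closure is there so that the projection is defined without a proof of this.) -/
def spectralProj (A : H →ₗ.[𝕜] H) (μ : ℝ) : H →L[𝕜] H :=
  (eigenspace A μ).topologicalClosure.starProjection

/-- `|A^{k/2} u|²` by the spectral resolution of `A`, which is a sum over the eigenvalues because
`A` has compact resolvent: `∑_μ μ^k |P_μ u|²`, where `P_μ` is the projection onto the eigenspace
of `μ`. It is `∞` exactly when `u` is not in `D(A^{k/2})`. For `k < 0` this is the norm of the
dual space `H_{-|k|}` on the elements of `H`. -/
def normSq (A : H →ₗ.[𝕜] H) (k : ℤ) (u : H) : ℝ≥0∞ :=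
  ∑' μ : ℝ, ENNReal.ofReal (μ ^ k) * ‖spectralProj A μ u‖ₑ ^ 2

/-- `u ∈ H_k = D(A^{k/2})`. -/
def MemH (A : H →ₗ.[𝕜] H) (k : ℤ) (u : H) : Prop :=
  normSq A k u < ∞

/-- The energy of level `k` of a pair: `e_k(w, v) = (|A^{k/2} w|² + |A^{(k-1)/2} v|²) / 2`. -/
def energy (A : H →ₗ.[𝕜] H) (k : ℤ) (w v : H) : ℝ :=
  1 / 2 * ((normSq A k w).toReal + (normSq A (k - 1) v).toReal)

/-- The hypotheses on the coupling operator alone: its adjoint maps `H_1` boundedly into itself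
(and `H_0 = H` into itself, since `C` is bounded), `‖C‖ = β` and `|C w|² ≤ β ⟨C w, w⟩`. -/
structure IsCoupling (A : H →ₗ.[𝕜] H) (C : H →L[𝕜] H) (β : ℝ) : Prop where
  adjoint_bounded : ∃ c : ℝ≥0, ∀ u : H, MemH A 1 u →
    normSq A 1 (ContinuousLinearMap.adjoint C u) ≤ c * normSq A 1 u
  norm_eq : ‖C‖ = β
  sq_le : ∀ w : H, ‖C w‖ ^ 2 ≤ β * RCLike.re ⟪C w, w⟫_𝕜

/-- Partial coercivity of the coupling operator: `α |Π w|² ≤ ⟨C w, w⟩` with `α > 0`. -/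
def IsPartiallyCoercive (C Pi : H →L[𝕜] H) (α : ℝ) : Prop :=
  0 < α ∧ ∀ w : H, α * ‖Pi w‖ ^ 2 ≤ RCLike.re ⟪C w, w⟫_𝕜

end Operators

section Evolution

variable {𝕜 H G : Type*} [RCLike 𝕜] [NormedAddCommGroup H] [InnerProductSpace 𝕜 H]
  [CompleteSpace H] [NormedSpace ℝ H] [IsScalarTower ℝ 𝕜 H]
  [NormedAddCommGroup G] [InnerProductSpace 𝕜 G] [CompleteSpace G]
  [NormedSpace ℝ G] [IsScalarTower ℝ 𝕜 G]

/-- `f ∈ L²([0,T]; E)`. -/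
def MemL2 {E : Type*} [NormedAddCommGroup E] (T : ℝ) (f : ℝ → E) : Prop :=
  MemLp f 2 (volume.restrict (Set.Icc 0 T))

/-- `(w, v)`, `v = w'`, is the (mild) solution of `w'' + A w = f` on `[0,T]`, with initial data
`(w 0, v 0) ∈ H_1 × H`: `(w, v) ∈ C([0,T]; H_1 × H)`, and the first order system `w' = v`,
`v' = -A w + f` holds in integrated form, `W(t) = W(0) + 𝒜 ∫₀ᵗ W + ∫₀ᵗ (0, f)`. -/
structure IsSolution (A : H →ₗ.[𝕜] H) (T : ℝ) (f w v : ℝ → H) : Prop where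
  mem_H1 : ∀ t ∈ Set.Icc 0 T, MemH A 1 (w t)
  continuous_w : ∀ t ∈ Set.Icc 0 T,
    Tendsto (fun s => normSq A 1 (w s - w t)) (𝓝[Set.Icc 0 T] t) (𝓝 0)
  continuous_v : ContinuousOn v (Set.Icc 0 T)
  eq_w : ∀ t ∈ Set.Icc 0 T, w t = w 0 + ∫ s in (0 : ℝ)..t, v s
  eq_v : ∀ t ∈ Set.Icc 0 T, ∃ h : (∫ s in (0 : ℝ)..t, w s) ∈ A.domain,
    v t = v 0 - A ⟨∫ s in (0 : ℝ)..t, w s, h⟩ + ∫ s in (0 : ℝ)..t, f s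

/-- `(u₁, u₂, v₁, v₂)`, `vᵢ = uᵢ'`, is the solution on `[0,T]` of the cascade system
`u₁'' + A u₁ = 0`, `u₂'' + A u₂ + C u₁ = 0`, with initial data in `H_1² × H²`. -/
structure IsCascadeSolution (A : H →ₗ.[𝕜] H) (C : H →L[𝕜] H) (T : ℝ)
    (u₁ u₂ v₁ v₂ : ℝ → H) : Prop where
  first : IsSolution A T (fun _ => 0) u₁ v₁
  second : IsSolution A T (fun t => -C (u₁ t)) u₂ v₂

/-- `y ∈ L²([0,T]; G)` is the observation `B*(w, v)` along a solution `(w, v)`.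
Here `B*` is defined on `D(A) × H` only, while `w(t)` is merely in `H_1`; but `∫₀ᵗ w ∈ D(A)` for
every solution, and `B*(w, v)` is the time derivative of `t ↦ B*(∫₀ᵗ w, ∫₀ᵗ v)`. If `w` is
continuous into `D(A)` this says `y(t) = B*(w(t), v(t))` for almost every `t`; in general it is
the extension of that map by continuity from such regular solutions. The function `y` is unique
up to a null set. -/
def IsObservation (A : H →ₗ.[𝕜] H) (Bs : (A.domain × H) →ₗ[𝕜] G) (T : ℝ)
    (w v : ℝ → H) (y : ℝ → G) : Prop :=
  MemL2 T y ∧ ∀ t ∈ Set.Icc 0 T, ∃ h : (∫ s in (0 : ℝ)..t, w s) ∈ A.domain,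
    ∫ s in (0 : ℝ)..t, y s = Bs (⟨∫ s in (0 : ℝ)..t, w s, h⟩, ∫ s in (0 : ℝ)..t, v s)

/-- `Π` observes the free equation through the velocity in every time `T > T₀`. -/
def ObservesVelocity (A : H →ₗ.[𝕜] H) (Pi : H →L[𝕜] H) (T₀ : ℝ) : Prop :=
  ∀ T > T₀, ∃ c : ℝ, 0 < c ∧ ∀ w v : ℝ → H, IsSolution A T (fun _ => 0) w v →
    c * energy A 1 (w 0) (v 0) ≤ ∫ t in (0 : ℝ)..T, ‖Pi (v t)‖ ^ 2

/-- `B* ∈ L(H_2 × H; G)`, where `H_2 = D(A)` carries the norm `|A ·|`, and `B*` is an admissible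
observation operator for the equation with a source term in `L²`. -/
def IsAdmissible (A : H →ₗ.[𝕜] H) (Bs : (A.domain × H) →ₗ[𝕜] G) : Prop :=
  (∃ c : ℝ, ∀ (u : A.domain) (v : H), ‖Bs (u, v)‖ ≤ c * (‖A u‖ + ‖v‖)) ∧
  ∀ T > 0, ∃ c : ℝ, 0 < c ∧ ∀ f w v : ℝ → H, MemL2 T f → IsSolution A T f w v →
    ∃ y : ℝ → G, IsObservation A Bs T w v y ∧
      ∫ t in (0 : ℝ)..T, ‖y t‖ ^ 2 ≤
        c * (energy A 1 (w 0) (v 0) + energy A 1 (w T) (v T)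
          + (∫ t in (0 : ℝ)..T, energy A 1 (w t) (v t)) + ∫ t in (0 : ℝ)..T, ‖f t‖ ^ 2)

/-- `B*` observes the free equation in every time `T > T₀`. -/
def Observes (A : H →ₗ.[𝕜] H) (Bs : (A.domain × H) →ₗ[𝕜] G) (T₀ : ℝ) : Prop :=
  ∀ T > T₀, ∃ c : ℝ, 0 < c ∧ ∀ w v : ℝ → H, IsSolution A T (fun _ => 0) w v →
    ∀ y : ℝ → G, IsObservation A Bs T w v y →
      c * energy A 1 (w 0) (v 0) ≤ ∫ t in (0 : ℝ)..T, ‖y t‖ ^ 2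

/-- `η₀` and `α₀` are uniform observability constants of `B*` for the times `T > τ`:
`∫₀ᵀ e₁(P) - α₀ ∫₀ᵀ |f|² ≤ η₀ ∫₀ᵀ ‖B* P‖²` for the solutions of `p'' + A p = f`. -/
def UniformlyObserves (A : H →ₗ.[𝕜] H) (Bs : (A.domain × H) →ₗ[𝕜] G) (τ η₀ α₀ : ℝ) : Prop :=
  ∀ T > τ, ∀ f w v : ℝ → H, MemL2 T f → IsSolution A T f w v →
    ∀ y : ℝ → G, IsObservation A Bs T w v y →
      (∫ t in (0 : ℝ)..T, energy A 1 (w t) (v t)) - α₀ * ∫ t in (0 : ℝ)..T, ‖f t‖ ^ 2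
        ≤ η₀ * ∫ t in (0 : ℝ)..T, ‖y t‖ ^ 2

/-- `γ₀` is a uniform observability constant of `Π` for the times `T > τ`:
`T e₁(V)(0) ≤ γ₀ ∫₀ᵀ |Π v'|²` for the solutions of `v'' + A v = 0`. -/
def UniformlyObservesVelocity (A : H →ₗ.[𝕜] H) (Pi : H →L[𝕜] H) (τ γ₀ : ℝ) : Prop :=
  ∀ T > τ, ∀ w v : ℝ → H, IsSolution A T (fun _ => 0) w v →
    T * energy A 1 (w 0) (v 0) ≤ γ₀ * ∫ t in (0 : ℝ)..T, ‖Pi (v t)‖ ^ 2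

end Evolution

section Constants

/-- The numerical constant `c₃`. -/
def c₃ : ℝ := 32

/-- The numerical constant `c₄`. -/
def c₄ : ℝ := 128

def constA (α β γ₀ : ℝ) : ℝ := c₃ * β * γ₀ / (2 * α)

def constB (α β γ₀ : ℝ) : ℝ := c₄ * β ^ 2 * γ₀ ^ 2 / (2 * α ^ 2)

/-- `M = s / ((2a+1)(a+s) + a + 2b)` with `s = √(a² + a + b)`. -/
def constM (α β γ₀ : ℝ) : ℝ :=
  let a := constA α β γ₀
  let b := constB α β γ₀
  let s := √(a ^ 2 + a + b)
  s / ((2 * a + 1) * (a + s) + a + 2 * b)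

def time₁ (α β γ₀ α₀ : ℝ) : ℝ := √(2 * c₄ * α₀) * β * γ₀ / α

def time₂ (α β γ₀ α₀ : ℝ) : ℝ := √(2 * c₃ * α₀ * β * γ₀) / √(α * constM α β γ₀)

/-- The observability time `T₃ = max (T₀, T₁, T₂)`. -/
def time₃ (T₀ α β γ₀ α₀ : ℝ) : ℝ := max T₀ (max (time₁ α β γ₀ α₀) (time₂ α β γ₀ α₀))

def constκ (α β γ₀ : ℝ) : ℝ := c₃ / constM α β γ₀ + c₄ * β * γ₀ / α

def d₁ (α β γ₀ α₀ η₀ T : ℝ) : ℝ :=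
  2 * η₀ * γ₀ ^ 2 / (α ^ 2 * (T ^ 2 - time₂ α β γ₀ α₀ ^ 2) * T) * constκ α β γ₀

def d₂ (α β γ₀ α₀ η₀ T : ℝ) : ℝ :=
  2 * η₀ * T / (constM α β γ₀ * (T ^ 2 - time₂ α β γ₀ α₀ ^ 2))

def k₂ (α β γ₀ α₀ η₀ T : ℝ) : ℝ :=
  2 * η₀ * T ^ 2 / (T ^ 2 - time₂ α β γ₀ α₀ ^ 2)

def r₂ (α β γ₀ α₀ η₀ T : ℝ) : ℝ :=
  2 * η₀ * γ₀ / (α * (T ^ 2 - time₂ α β γ₀ α₀ ^ 2)) * constκ α β γ₀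

/-- The constant `K` in the asymptotic bounds, which does not depend on `T`. -/
def constK (α β γ₀ η₀ : ℝ) : ℝ :=
  4 * η₀ * (1 + 1 / constM α β γ₀ + (γ₀ / α + γ₀ ^ 2 / α ^ 2) * constκ α β γ₀)

end Constants

section Conclusion

variable {𝕜 H G : Type*} [RCLike 𝕜] [NormedAddCommGroup H] [InnerProductSpace 𝕜 H]
  [CompleteSpace H] [NormedSpace ℝ H] [IsScalarTower ℝ 𝕜 H]
  [NormedAddCommGroup G] [InnerProductSpace 𝕜 G] [CompleteSpace G]
  [NormedSpace ℝ G] [IsScalarTower ℝ 𝕜 G]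

/-- The four estimates at time `T` for all solutions of the cascade system, where `y = B* U₂`. -/
def CascadeEstimates (A : H →ₗ.[𝕜] H) (C : H →L[𝕜] H) (Bs : (A.domain × H) →ₗ[𝕜] G)
    (T d₁T d₂T k₂T r₂T : ℝ) : Prop :=
  ∀ u₁ u₂ v₁ v₂ : ℝ → H, IsCascadeSolution A C T u₁ u₂ v₁ v₂ →
    ∃ y : ℝ → G, IsObservation A Bs T u₂ v₂ y ∧
      energy A 0 (u₁ 0) (v₁ 0) ≤ d₁T * (∫ t in (0 : ℝ)..T, ‖y t‖ ^ 2) ∧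
      energy A 1 (u₂ 0) (v₂ 0) ≤ d₂T * (∫ t in (0 : ℝ)..T, ‖y t‖ ^ 2) ∧
      (∫ t in (0 : ℝ)..T, energy A 1 (u₂ t) (v₂ t)) ≤ k₂T * (∫ t in (0 : ℝ)..T, ‖y t‖ ^ 2) ∧
      (∫ t in (0 : ℝ)..T, RCLike.re ⟪C (u₁ t), u₁ t⟫_𝕜)
        ≤ r₂T * (∫ t in (0 : ℝ)..T, ‖y t‖ ^ 2)

/-- The conclusion. First, uniform observability constants `η₀, α₀, γ₀` exist for the times beyond
any `τ > T₀`. Second, for any such `τ, η₀, α₀, γ₀` the estimates hold for all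
`T > T₃ = max (τ, T₁, T₂)`, with the explicit positive constants and their bounds for large `T`. -/
def CascadeObservability (A : H →ₗ.[𝕜] H) (C Pi : H →L[𝕜] H) (Bs : (A.domain × H) →ₗ[𝕜] G)
    (α β T₀ : ℝ) : Prop :=
  (∀ τ > T₀, ∃ η₀ > 0, ∃ α₀ > 0, ∃ γ₀ > 0,
    UniformlyObserves A Bs τ η₀ α₀ ∧ UniformlyObservesVelocity A Pi τ γ₀) ∧
  ∀ τ > 0, ∀ η₀ > 0, ∀ α₀ > 0, ∀ γ₀ > 0,
    UniformlyObserves A Bs τ η₀ α₀ → UniformlyObservesVelocity A Pi τ γ₀ →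
    0 < constK α β γ₀ η₀ ∧
    ∀ T > time₃ τ α β γ₀ α₀,
      CascadeEstimates A C Bs T (d₁ α β γ₀ α₀ η₀ T) (d₂ α β γ₀ α₀ η₀ T)
        (k₂ α β γ₀ α₀ η₀ T) (r₂ α β γ₀ α₀ η₀ T) ∧
      0 < d₁ α β γ₀ α₀ η₀ T ∧ 0 < d₂ α β γ₀ α₀ η₀ T ∧
      (√2 * time₂ α β γ₀ α₀ ≤ T →
        d₁ α β γ₀ α₀ η₀ T ≤ constK α β γ₀ η₀ / T ^ 3 ∧
        d₂ α β γ₀ α₀ η₀ T ≤ constK α β γ₀ η₀ / T ∧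
        k₂ α β γ₀ α₀ η₀ T ≤ constK α β γ₀ η₀ ∧
        r₂ α β γ₀ α₀ η₀ T ≤ constK α β γ₀ η₀ / T ^ 2)

end Conclusion

end Cascade

end

open MeasureTheory Filter Topology
open scoped ENNReal NNReal InnerProductSpace

set_option linter.unusedSectionVars false

noncomputable section

namespace Cascade

/-! ### Spectral decomposition of the generator -/

section Spectral

variable {𝕜 H : Type*} [RCLike 𝕜] [NormedAddCommGroup H] [InnerProductSpace 𝕜 H]
  [CompleteSpace H] {A : H →ₗ.[𝕜] H}

/-! The unobserved component is reached through the coupling term `X = ∫ Re⟪C u₁, u₁⟫`. Since `u₁`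
lies only at level `0`, it is lifted: `z = -A⁻¹ u₁'` solves the free equation with `z' = u₁`, and
`e₁(z, u₁) = e₀(U₁)`. Velocity observability of `(z, u₁)` and partial coercivity give `T e₀(U₁)(0) ≤
(γ₀/α) X`.

The pair `U₂ + (z, u₁)` solves the same equation as `U₂`, with source `-C u₁`. Subtracting the two
energy identities over `[0,T]` leaves exactly `-X` from the source, so `X` is a combination of the
energies of the two solutions at the times `0` and `T`. Young's inequality with a weight of order
`1/T`, and conservation of the energy of `z`, turn this into `X ≤ (8γ₀/(αT)) (E₀ + E₁)`, with `E₀`,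
`E₁` the energies of `U₂` at the two ends (`IsCascadeSolution.coupling_le`). Conversely the energy
of `U₂` at any time exceeds its mean by at most the work of `C u₁`, and `|C u₁|² ≤ β Re⟪C u₁, u₁⟫`
bounds that work by `X` and `I = ∫ e₁(U₂)`. Playing the two bounds against each other gives `X ≲
I/T²` and `E₀ ≲ I/T` (`coupling_bounds`). Finally, observability with a source bounds `I` by `η₀ ∫
‖B* U₂‖² + α₀ β X`, and for `T > T₃` the last term is absorbed into `I`.

The uniform constants of part (a) come from observability on one window of length `τ`. A source is
handled by subtracting the free solution with the same data: the remainder starts from zero, so its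
energy and, by admissibility, its observation are controlled by the source. Covering `[0,T]` by
windows that overlap at most twice keeps the constants independent of `T`.

All this rests on the energy identity for mild solutions (`IsSolution.energy_eq`). It is proved on
each eigenspace, where `A` is multiplication by a number, and then summed over the spectrum. -/

theorem mem_eigenspace_iff {μ : ℝ} {x : H} :
    x ∈ eigenspace A μ ↔ ∃ h : x ∈ A.domain, A ⟨x, h⟩ = (μ : 𝕜) • x := by
  simp only [eigenspace, Submodule.mem_comap, LinearPMap.mem_graph_iff, LinearMap.prod_apply]
  constructor
  · rintro ⟨⟨y, hy⟩, rfl, h⟩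
    exact ⟨hy, h⟩
  · rintro ⟨h, h'⟩
    exact ⟨⟨x, h⟩, rfl, h'⟩

theorem IsAdmissibleGenerator.inner_symm (hA : IsAdmissibleGenerator A) (u v : A.domain) :
    ⟪A u, (v : H)⟫_𝕜 = ⟪(u : H), A v⟫_𝕜 := by
  have h := LinearPMap.adjoint_isFormalAdjoint hA.selfAdjoint.dense_domain
  rw [LinearPMap.isSelfAdjoint_def.mp hA.selfAdjoint] at h
  exact h u v

theorem IsAdmissibleGenerator.injective (hA : IsAdmissibleGenerator A) {u v : A.domain}
    (h : A u = A v) : u = v := by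
  obtain ⟨ω, hω, hb⟩ := hA.bounded_below
  have h1 := hb (u - v)
  rw [LinearPMap.map_sub, h, sub_self, norm_zero] at h1
  have h2 : ‖((u - v : A.domain) : H)‖ ≤ 0 := by
    by_contra hc
    push Not at hc
    nlinarith [mul_pos hω hc]
  rw [← sub_eq_zero]
  exact Subtype.ext (norm_le_zero_iff.mp h2)

/-- An admissible generator has a compact, symmetric, everywhere defined inverse. -/
theorem IsAdmissibleGenerator.exists_inverse (hA : IsAdmissibleGenerator A) :
    ∃ S : H →L[𝕜] H, IsCompactOperator S ∧ S.IsSymmetric ∧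
      (∀ x, ∃ h : S x ∈ A.domain, A ⟨S x, h⟩ = x) ∧ ∀ u : A.domain, S (A u) = u := by
  obtain ⟨μ, R, hR, hR1, -⟩ := hA.compact_resolvent
  have hAR : ∀ x, ∃ h : R x ∈ A.domain, A ⟨R x, h⟩ = x + μ • R x := fun x => by
    obtain ⟨h, h'⟩ := hR1 x
    exact ⟨h, sub_eq_iff_eq_add.mp h'⟩
  obtain ⟨V, hV⟩ : ∃ V : H →L[𝕜] H, ∀ x, V x + μ • R (V x) = x := by
    by_cases hμ : μ = 0
    · exact ⟨ContinuousLinearMap.id 𝕜 H, fun x => by simp [hμ]⟩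
    -- Fredholm alternative for `R` at `-μ⁻¹`. An eigenvector `x` would satisfy `A (R x) = x + μ R x
    -- = 0`, against injectivity of `A`. Hence `1 + μ R` has a right inverse `V`, and `A (R V x) =
    -- x`.
    rcases hR.hasEigenvalue_or_mem_resolventSet (neg_ne_zero.mpr (inv_ne_zero hμ)) with h | h
    · exfalso
      obtain ⟨x, hx, hx0⟩ := h.exists_hasEigenvector
      rw [Module.End.mem_eigenspace_iff] at hx
      obtain ⟨h1, h2⟩ := hAR x
      have hx' : R x = (-μ⁻¹) • x := hx
      have h3 : A ⟨R x, h1⟩ = A 0 := by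
        rw [h2, hx', smul_smul, mul_neg, mul_inv_cancel₀ hμ, LinearPMap.map_zero]; simp
      have h4 := congrArg (Subtype.val) (hA.injective h3)
      simp only [hx', ZeroMemClass.coe_zero, smul_eq_zero, neg_eq_zero, inv_eq_zero] at h4
      exact h4.elim hμ hx0
    · rw [spectrum.mem_resolventSet_iff] at h
      obtain ⟨W, hW⟩ := h.exists_right_inv
      refine ⟨(-μ⁻¹) • W, fun x => ?_⟩
      have h1 : (-μ⁻¹) • W x - R (W x) = x := by
        have := congrArg (fun L : H →L[𝕜] H => L x) hW
        simpa [Algebra.algebraMap_eq_smul_one] using this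
      have h2 : ((-μ⁻¹) • W) x = (-μ⁻¹) • W x := rfl
      conv_rhs => rw [← h1]
      rw [h2, map_smul, smul_smul, mul_neg, mul_inv_cancel₀ hμ, neg_smul 1, one_smul,
        ← sub_eq_add_neg]
  have hAS : ∀ x, ∃ h : R (V x) ∈ A.domain, A ⟨R (V x), h⟩ = x := fun x => by
    obtain ⟨h, h'⟩ := hAR (V x)
    exact ⟨h, h'.trans (hV x)⟩
  refine ⟨R.comp V, hR.comp_clm V, fun x y => ?_, hAS, fun u => ?_⟩
  · obtain ⟨hx, hx'⟩ := hAS x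
    obtain ⟨hy, hy'⟩ := hAS y
    have := hA.inner_symm ⟨_, hx⟩ ⟨_, hy⟩
    rw [hx', hy'] at this
    exact this.symm
  · obtain ⟨h, h'⟩ := hAS (A u)
    exact congrArg Subtype.val (hA.injective h')

theorem IsAdmissibleGenerator.isClosed_eigenspace (hA : IsAdmissibleGenerator A) (μ : ℝ) :
    IsClosed (eigenspace A μ : Set H) := by
  have h : IsClosed (A.graph : Set (H × H)) := hA.selfAdjoint.isClosed
  exact h.preimage (f := fun x : H => (x, (μ : 𝕜) • x)) (by fun_prop)

theorem IsAdmissibleGenerator.closure_eigenspace (hA : IsAdmissibleGenerator A) (μ : ℝ) :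
    (eigenspace A μ).topologicalClosure = eigenspace A μ :=
  IsClosed.submodule_topologicalClosure_eq (hA.isClosed_eigenspace μ)

theorem IsAdmissibleGenerator.spectralProj_mem (hA : IsAdmissibleGenerator A) (μ : ℝ) (x : H) :
    spectralProj A μ x ∈ eigenspace A μ := by
  rw [← hA.closure_eigenspace μ]
  exact Submodule.starProjection_apply_mem _ x

theorem spectralProj_of_mem {μ : ℝ} {x : H} (hx : x ∈ eigenspace A μ) :
    spectralProj A μ x = x :=
  Submodule.starProjection_eq_self_iff.mpr (Submodule.le_topologicalClosure _ hx)

theorem inner_spectralProj_left (μ : ℝ) (x y : H) :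
    ⟪spectralProj A μ x, y⟫_𝕜 = ⟪x, spectralProj A μ y⟫_𝕜 :=
  Submodule.inner_starProjection_left_eq_right _ x y

/-- Positivity excludes `μ < 0` and the lower bound excludes `μ = 0`. Sums over all real `μ`
therefore see only `μ > 0`, and the values of `μ ^ k` or `√μ` elsewhere are harmless. -/
theorem IsAdmissibleGenerator.eigenspace_eq_bot (hA : IsAdmissibleGenerator A) {μ : ℝ}
    (hμ : μ ≤ 0) : eigenspace A μ = ⊥ := by
  rw [Submodule.eq_bot_iff]
  intro x hx
  obtain ⟨h, h'⟩ := mem_eigenspace_iff.mp hx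
  obtain ⟨ω, hω, hb⟩ := hA.bounded_below
  have h1 := hA.positive ⟨x, h⟩
  have h2 := hb ⟨x, h⟩
  rw [h'] at h1 h2
  simp only [inner_smul_left, RCLike.conj_ofReal, RCLike.re_ofReal_mul,
    inner_self_eq_norm_sq] at h1
  rw [norm_smul, RCLike.norm_ofReal] at h2
  by_contra hx0
  have hpos : 0 < ‖x‖ := norm_pos_iff.mpr hx0
  have h3 : 0 ≤ μ := nonneg_of_mul_nonneg_left h1 (by positivity)
  have h4 : μ = 0 := le_antisymm hμ h3
  simp only [h4, abs_zero, zero_mul] at h2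
  nlinarith [mul_pos hω hpos]

theorem IsAdmissibleGenerator.spectralProj_eq_zero (hA : IsAdmissibleGenerator A) {μ : ℝ}
    (hμ : μ ≤ 0) (x : H) : spectralProj A μ x = 0 := by
  have := hA.spectralProj_mem μ x
  rwa [hA.eigenspace_eq_bot hμ, Submodule.mem_bot] at this

theorem IsAdmissibleGenerator.orthogonalFamily (hA : IsAdmissibleGenerator A) :
    OrthogonalFamily 𝕜 (fun μ : ℝ => eigenspace A μ) fun μ => (eigenspace A μ).subtypeₗᵢ := by
  rintro μ ν hμν ⟨x, hx⟩ ⟨y, hy⟩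
  obtain ⟨h, h'⟩ := mem_eigenspace_iff.mp hx
  obtain ⟨k, k'⟩ := mem_eigenspace_iff.mp hy
  have := hA.inner_symm ⟨x, h⟩ ⟨y, k⟩
  rw [h', k', inner_smul_left, inner_smul_right, RCLike.conj_ofReal, ← sub_eq_zero,
    ← sub_mul, mul_eq_zero, sub_eq_zero] at this
  rcases this with h1 | h1
  · exact absurd (RCLike.ofReal_injective h1) hμν
  · exact h1

theorem IsAdmissibleGenerator.spectralProj_of_mem_ne (hA : IsAdmissibleGenerator A) {μ ν : ℝ}
    (h : μ ≠ ν) {x : H} (hx : x ∈ eigenspace A μ) : spectralProj A ν x = 0 := by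
  rw [spectralProj, Submodule.starProjection_apply_eq_zero_iff, hA.closure_eigenspace]
  intro y hy
  exact hA.orthogonalFamily h.symm ⟨y, hy⟩ ⟨x, hx⟩

/-- The spectral projections separate points. -/
theorem IsAdmissibleGenerator.eq_zero_of_spectralProj (hA : IsAdmissibleGenerator A) {x : H}
    (hx : ∀ μ, spectralProj A μ x = 0) : x = 0 := by
  obtain ⟨S, hc, hs, hS1, hS2⟩ := hA.exists_inverse
  have h := ContinuousLinearMap.orthogonalComplement_iSup_eigenspaces_eq_bot hc hs
  have : x ∈ (⨆ ν, Module.End.eigenspace (S : Module.End 𝕜 H) ν)ᗮ := by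
    rw [← Submodule.iInf_orthogonal, Submodule.mem_iInf]
    intro ν z hz
    by_cases hz0 : z = 0
    · simp [hz0]
    have hz' : S z = ν • z := Module.End.mem_eigenspace_iff.mp hz
    obtain ⟨k, k'⟩ := hS1 z
    have hreal : (RCLike.re ν : 𝕜) = ν := RCLike.conj_eq_iff_re.mp
      (hs.conj_eigenvalue_eq_self (Module.End.hasEigenvalue_of_hasEigenvector ⟨hz, hz0⟩))
    have hν : ν ≠ 0 := by
      rintro rfl
      rw [zero_smul] at hz'
      apply hz0
      rw [← k']
      have : (⟨S z, k⟩ : A.domain) = 0 := Subtype.ext hz'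
      rw [this, LinearPMap.map_zero]
    -- Eigenvectors of `A⁻¹` for `ν` are eigenvectors of `A` for `ν⁻¹`, which is real by symmetry.
    -- So `x` is orthogonal to every eigenspace of the compact symmetric operator `S`, and these
    -- span a dense subspace.
    have hmem : z ∈ eigenspace A (RCLike.re ν)⁻¹ := by
      have h1 : z = ν⁻¹ • S z := by rw [hz', smul_smul, inv_mul_cancel₀ hν, one_smul]
      have h2 : z ∈ A.domain := by rw [h1]; exact A.domain.smul_mem _ k
      refine mem_eigenspace_iff.mpr ⟨h2, ?_⟩
      have : (⟨z, h2⟩ : A.domain) = ν⁻¹ • ⟨S z, k⟩ := Subtype.ext h1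
      rw [this, LinearPMap.map_smul, k', RCLike.ofReal_inv, hreal]
    rw [← spectralProj_of_mem hmem, inner_spectralProj_left, hx, inner_zero_right]
  rwa [h, Submodule.mem_bot] at this

theorem IsAdmissibleGenerator.eq_of_spectralProj (hA : IsAdmissibleGenerator A) {x y : H}
    (h : ∀ μ, spectralProj A μ x = spectralProj A μ y) : x = y := by
  rw [← sub_eq_zero]
  exact hA.eq_zero_of_spectralProj fun μ => by rw [map_sub, h, sub_self]

/-- A square summable family of eigenvectors is the family of components of its sum. -/
theorem IsAdmissibleGenerator.exists_of_components (hA : IsAdmissibleGenerator A) {c : ℝ → H}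
    (hc : ∀ μ, c μ ∈ eigenspace A μ) (hs : Summable fun μ => ‖c μ‖ ^ 2) :
    ∃ x, HasSum c x ∧ ∀ μ, spectralProj A μ x = c μ := by
  have h := (hA.orthogonalFamily.summable_iff_norm_sq_summable fun μ => ⟨c μ, hc μ⟩).mpr hs
  obtain ⟨x, hx⟩ := h
  refine ⟨x, hx, fun μ => ?_⟩
  have h1 := hx.mapL (spectralProj A μ)
  have h2 := hasSum_single (f := fun ν => spectralProj A μ (c ν)) μ
    fun ν hν => hA.spectralProj_of_mem_ne hν (hc ν)
  rw [spectralProj_of_mem (hc μ)] at h2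
  exact h1.unique h2

theorem IsAdmissibleGenerator.norm_sq_sum_spectralProj (hA : IsAdmissibleGenerator A)
    (F : Finset ℝ) (x : H) : ‖∑ μ ∈ F, spectralProj A μ x‖ ^ 2 =
      ∑ μ ∈ F, ‖spectralProj A μ x‖ ^ 2 :=
  hA.orthogonalFamily.norm_sum (fun μ => ⟨spectralProj A μ x, hA.spectralProj_mem μ x⟩) F

theorem IsAdmissibleGenerator.sum_norm_sq_eq (hA : IsAdmissibleGenerator A)
    (F : Finset ℝ) (x : H) : ∑ μ ∈ F, ‖spectralProj A μ x‖ ^ 2 =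
      RCLike.re ⟪∑ μ ∈ F, spectralProj A μ x, x⟫_𝕜 := by
  rw [sum_inner, map_sum]
  refine Finset.sum_congr rfl fun μ _ => ?_
  rw [← inner_self_eq_norm_sq (𝕜 := 𝕜), inner_spectralProj_left, spectralProj_of_mem
    (hA.spectralProj_mem μ x), inner_spectralProj_left]

/-- Bessel's inequality: the square of the left side equals `Re⟪∑ P_μ x, x⟫`, to which
Cauchy–Schwarz applies. -/
theorem IsAdmissibleGenerator.norm_sum_spectralProj_le (hA : IsAdmissibleGenerator A)
    (F : Finset ℝ) (x : H) : ‖∑ μ ∈ F, spectralProj A μ x‖ ≤ ‖x‖ := by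
  have h := hA.norm_sq_sum_spectralProj F x
  rw [hA.sum_norm_sq_eq] at h
  have h2 := re_inner_le_norm (𝕜 := 𝕜) (∑ μ ∈ F, spectralProj A μ x) x
  by_contra hc
  push Not at hc
  nlinarith [norm_nonneg x]

/-- By Bessel the components are square summable, hence have a sum. That sum has the same components
as `x`, and components determine a vector. -/
theorem IsAdmissibleGenerator.hasSum_spectralProj (hA : IsAdmissibleGenerator A) (x : H) :
    HasSum (fun μ => spectralProj A μ x) x := by
  have hs : Summable fun μ => ‖spectralProj A μ x‖ ^ 2 := by
    refine summable_of_sum_le (c := ‖x‖ ^ 2) (fun μ => by positivity) fun F => ?_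
    rw [← hA.norm_sq_sum_spectralProj]
    gcongr
    exact hA.norm_sum_spectralProj_le F x
  obtain ⟨y, hy, hy'⟩ := hA.exists_of_components (hA.spectralProj_mem · x) hs
  rwa [hA.eq_of_spectralProj hy'] at hy

/-- Parseval's identity. -/
theorem IsAdmissibleGenerator.hasSum_norm_sq (hA : IsAdmissibleGenerator A) (x : H) :
    HasSum (fun μ => ‖spectralProj A μ x‖ ^ 2) (‖x‖ ^ 2) := by
  have h := ((hA.hasSum_spectralProj x).norm).pow 2
  refine h.congr fun F => ?_
  exact hA.norm_sq_sum_spectralProj F x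

/-- Tested against an eigenvector for `μ`, symmetry moves `A` onto the eigenvector and produces the
factor `μ`. -/
theorem IsAdmissibleGenerator.spectralProj_apply (hA : IsAdmissibleGenerator A) (μ : ℝ)
    (u : A.domain) : spectralProj A μ (A u) = (μ : 𝕜) • spectralProj A μ u := by
  rw [spectralProj]
  refine Submodule.eq_starProjection_of_mem_of_inner_eq_zero
    (Submodule.smul_mem _ _ (Submodule.starProjection_apply_mem _ _)) ?_
  intro z hz
  rw [hA.closure_eigenspace] at hz
  obtain ⟨k, k'⟩ := mem_eigenspace_iff.mp hz
  have h1 := hA.inner_symm u ⟨z, k⟩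
  have h2 : ⟪spectralProj A μ u, z⟫_𝕜 = ⟪(u : H), z⟫_𝕜 := by
    rw [inner_spectralProj_left, spectralProj_of_mem hz]
  rw [k', inner_smul_right] at h1
  change ⟪A u - (μ : 𝕜) • spectralProj A μ u, z⟫_𝕜 = 0
  rw [inner_sub_left, inner_smul_left, RCLike.conj_ofReal, h1, h2, sub_self]

/-- `A x = y` can be checked on components. -/
theorem IsAdmissibleGenerator.mem_domain_of_spectralProj (hA : IsAdmissibleGenerator A) {x y : H}
    (h : ∀ μ : ℝ, spectralProj A μ y = (μ : 𝕜) • spectralProj A μ x) :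
    ∃ hx : x ∈ A.domain, A ⟨x, hx⟩ = y := by
  obtain ⟨S, -, -, hS1, -⟩ := hA.exists_inverse
  obtain ⟨k, k'⟩ := hS1 y
  suffices hxy : x = S y by subst hxy; exact ⟨k, k'⟩
  refine hA.eq_of_spectralProj fun μ => ?_
  rcases le_or_gt μ 0 with hμ | hμ
  · rw [hA.spectralProj_eq_zero hμ, hA.spectralProj_eq_zero hμ]
  · have h1 := hA.spectralProj_apply μ ⟨_, k⟩
    rw [k', h μ] at h1
    exact (smul_right_injective H (r := (μ : 𝕜)) (by simpa using hμ.ne')) h1.symm |>.symm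

end Spectral

/-! ### Energies as sums over the spectrum -/

section EnergySum

variable {𝕜 H : Type*} [RCLike 𝕜] [NormedAddCommGroup H] [InnerProductSpace 𝕜 H]
  [CompleteSpace H] {A : H →ₗ.[𝕜] H}

theorem IsAdmissibleGenerator.zpow_mul_nonneg (hA : IsAdmissibleGenerator A) (k : ℤ) (u : H)
    (μ : ℝ) : 0 ≤ μ ^ k * ‖spectralProj A μ u‖ ^ 2 := by
  rcases le_or_gt μ 0 with hμ | hμ
  · simp [hA.spectralProj_eq_zero hμ]
  · positivity

theorem IsAdmissibleGenerator.mul_norm_sq_nonneg (hA : IsAdmissibleGenerator A) (u : H)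
    (μ : ℝ) : 0 ≤ μ * ‖spectralProj A μ u‖ ^ 2 := by
  simpa using hA.zpow_mul_nonneg 1 u μ

theorem IsAdmissibleGenerator.normSq_eq (hA : IsAdmissibleGenerator A) (k : ℤ) (u : H) :
    normSq A k u = ∑' μ : ℝ, ENNReal.ofReal (μ ^ k * ‖spectralProj A μ u‖ ^ 2) := by
  refine tsum_congr fun μ => ?_
  rcases le_or_gt μ 0 with hμ | hμ
  · simp [hA.spectralProj_eq_zero hμ]
  · rw [ENNReal.ofReal_mul (by positivity), ENNReal.ofReal_pow (norm_nonneg _), ofReal_norm]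

theorem IsAdmissibleGenerator.memH_iff (hA : IsAdmissibleGenerator A) {k : ℤ} {u : H} :
    MemH A k u ↔ Summable fun μ : ℝ => μ ^ k * ‖spectralProj A μ u‖ ^ 2 := by
  rw [MemH, hA.normSq_eq]
  constructor
  · intro h
    have := ENNReal.summable_toReal h.ne
    simpa only [ENNReal.toReal_ofReal (hA.zpow_mul_nonneg k u _)] using this
  · intro h
    rw [← ENNReal.ofReal_tsum_of_nonneg (hA.zpow_mul_nonneg k u) h]
    exact ENNReal.ofReal_lt_top

theorem IsAdmissibleGenerator.toReal_normSq (hA : IsAdmissibleGenerator A) (k : ℤ) (u : H) :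
    (normSq A k u).toReal = ∑' μ : ℝ, μ ^ k * ‖spectralProj A μ u‖ ^ 2 := by
  rw [hA.normSq_eq, ENNReal.tsum_toReal_eq fun _ => ENNReal.ofReal_ne_top]
  exact tsum_congr fun μ => ENNReal.toReal_ofReal (hA.zpow_mul_nonneg k u μ)

theorem IsAdmissibleGenerator.toReal_normSq_zero (hA : IsAdmissibleGenerator A) (u : H) :
    (normSq A 0 u).toReal = ‖u‖ ^ 2 := by
  rw [hA.toReal_normSq]
  simpa using (hA.hasSum_norm_sq u).tsum_eq

theorem IsAdmissibleGenerator.hasSum_energy (hA : IsAdmissibleGenerator A) {w : H}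
    (hw : MemH A 1 w) (v : H) :
    HasSum (fun μ : ℝ => 1 / 2 * (μ * ‖spectralProj A μ w‖ ^ 2 + ‖spectralProj A μ v‖ ^ 2))
      (energy A 1 w v) := by
  have h := hA.memH_iff.mp hw
  refine HasSum.mul_left _ (HasSum.add ?_ ?_)
  · rw [hA.toReal_normSq]
    simpa using h.hasSum
  · rw [sub_self, hA.toReal_normSq_zero]
    exact hA.hasSum_norm_sq v

theorem energy_nonneg (k : ℤ) (w v : H) : 0 ≤ energy A k w v := by
  unfold energy
  positivity

theorem IsAdmissibleGenerator.norm_sq_le_energy (hA : IsAdmissibleGenerator A) (w v : H) :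
    ‖v‖ ^ 2 ≤ 2 * energy A 1 w v := by
  unfold energy
  rw [sub_self, hA.toReal_normSq_zero]
  linarith [ENNReal.toReal_nonneg (a := normSq A 1 w)]

/-- Young's inequality. The weight stays free because the coupling estimate needs it of order `1/T`;
elsewhere `θ = 1` suffices. -/
theorem norm_add_sq_le_of_pos {θ : ℝ} (hθ : 0 < θ) (x y : H) :
    ‖x + y‖ ^ 2 ≤ (1 + θ) * ‖x‖ ^ 2 + (1 + θ⁻¹) * ‖y‖ ^ 2 := by
  have h1 : ‖x + y‖ ^ 2 ≤ (‖x‖ + ‖y‖) ^ 2 := by gcongr; exact norm_add_le x y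
  have h2 : θ * ‖x‖ ^ 2 + θ⁻¹ * ‖y‖ ^ 2 - 2 * ‖x‖ * ‖y‖ = θ⁻¹ * (θ * ‖x‖ - ‖y‖) ^ 2 := by
    field_simp
    ring
  have h3 : 0 ≤ θ⁻¹ * (θ * ‖x‖ - ‖y‖) ^ 2 := by positivity
  nlinarith

theorem le_norm_add_sq_of_pos {θ : ℝ} (hθ : 0 < θ) (x y : H) :
    (1 - θ) * ‖x‖ ^ 2 + (1 - θ⁻¹) * ‖y‖ ^ 2 ≤ ‖x + y‖ ^ 2 := by
  have h1 : (‖x‖ - ‖y‖) ^ 2 ≤ ‖x + y‖ ^ 2 := by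
    rw [sq_le_sq, abs_norm]
    have := abs_norm_sub_norm_le x (-y)
    rwa [norm_neg, sub_neg_eq_add] at this
  have h2 : θ * ‖x‖ ^ 2 + θ⁻¹ * ‖y‖ ^ 2 - 2 * ‖x‖ * ‖y‖ = θ⁻¹ * (θ * ‖x‖ - ‖y‖) ^ 2 := by
    field_simp
    ring
  have h3 : 0 ≤ θ⁻¹ * (θ * ‖x‖ - ‖y‖) ^ 2 := by positivity
  nlinarith

theorem IsAdmissibleGenerator.normSq_one_add_le (hA : IsAdmissibleGenerator A) (x y : H) :
    normSq A 1 (x + y) ≤ 2 * (normSq A 1 x + normSq A 1 y) := by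
  rw [hA.normSq_eq, hA.normSq_eq, hA.normSq_eq, ← ENNReal.tsum_add, ← ENNReal.tsum_mul_left]
  refine ENNReal.tsum_le_tsum fun μ => ?_
  rw [← ENNReal.ofReal_add (hA.zpow_mul_nonneg _ _ _) (hA.zpow_mul_nonneg _ _ _),
    ← ENNReal.ofReal_ofNat 2, ← ENNReal.ofReal_mul (by norm_num)]
  refine ENNReal.ofReal_le_ofReal ?_
  rcases le_or_gt μ 0 with hμ | hμ
  · simp [hA.spectralProj_eq_zero hμ]
  · have := norm_add_sq_le_of_pos one_pos (spectralProj A μ x) (spectralProj A μ y)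
    rw [map_add, zpow_one]
    nlinarith

theorem normSq_neg (k : ℤ) (x : H) : normSq A k (-x) = normSq A k x := by
  simp [normSq]

theorem IsAdmissibleGenerator.memH_add (hA : IsAdmissibleGenerator A) {x y : H}
    (hx : MemH A 1 x) (hy : MemH A 1 y) : MemH A 1 (x + y) :=
  (hA.normSq_one_add_le x y).trans_lt
    (ENNReal.mul_lt_top (by norm_num) (ENNReal.add_lt_top.mpr ⟨hx, hy⟩))

theorem memH_neg {k : ℤ} {x : H} (hx : MemH A k x) : MemH A k (-x) := by
  rwa [MemH, normSq_neg]

theorem IsAdmissibleGenerator.energy_add_le (hA : IsAdmissibleGenerator A) {θ : ℝ} (hθ : 0 < θ)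
    {w₁ w₂ : H} (h₁ : MemH A 1 w₁) (h₂ : MemH A 1 w₂) (v₁ v₂ : H) :
    energy A 1 (w₁ + w₂) (v₁ + v₂) ≤
      (1 + θ) * energy A 1 w₁ v₁ + (1 + θ⁻¹) * energy A 1 w₂ v₂ := by
  refine hasSum_le (fun μ => ?_) (hA.hasSum_energy (hA.memH_add h₁ h₂) (v₁ + v₂))
    (((hA.hasSum_energy h₁ v₁).mul_left _).add ((hA.hasSum_energy h₂ v₂).mul_left _))
  have h4 := norm_add_sq_le_of_pos hθ (spectralProj A μ v₁) (spectralProj A μ v₂)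
  rw [map_add, map_add]
  rcases le_or_gt μ 0 with hμ | hμ
  · simp [hA.spectralProj_eq_zero hμ]
  · have h3 := mul_le_mul_of_nonneg_left
      (norm_add_sq_le_of_pos hθ (spectralProj A μ w₁) (spectralProj A μ w₂)) hμ.le
    linarith

/-- Companion of `energy_add_le`. Their coefficients of `e(w₂, v₂)` differ only by `2θ⁻¹`, so when
that energy is conserved its leading parts cancel in a difference between two times. -/
theorem IsAdmissibleGenerator.le_energy_add (hA : IsAdmissibleGenerator A) {θ : ℝ} (hθ : 0 < θ)
    {w₁ w₂ : H} (h₁ : MemH A 1 w₁) (h₂ : MemH A 1 w₂) (v₁ v₂ : H) :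
    (1 - θ) * energy A 1 w₁ v₁ + (1 - θ⁻¹) * energy A 1 w₂ v₂ ≤
      energy A 1 (w₁ + w₂) (v₁ + v₂) := by
  refine hasSum_le (fun μ => ?_)
    (((hA.hasSum_energy h₁ v₁).mul_left _).add ((hA.hasSum_energy h₂ v₂).mul_left _))
    (hA.hasSum_energy (hA.memH_add h₁ h₂) (v₁ + v₂))
  have h4 := le_norm_add_sq_of_pos hθ (spectralProj A μ v₁) (spectralProj A μ v₂)
  rw [map_add, map_add]
  rcases le_or_gt μ 0 with hμ | hμ
  · simp [hA.spectralProj_eq_zero hμ]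
  · have h3 := mul_le_mul_of_nonneg_left
      (le_norm_add_sq_of_pos hθ (spectralProj A μ w₁) (spectralProj A μ w₂)) hμ.le
    linarith

/-- `∑_{μ ∈ F} P_μ → 1` uniformly on compact sets. -/
theorem IsAdmissibleGenerator.eventually_norm_sum_sub_le (hA : IsAdmissibleGenerator A)
    {K : Set H} (hK : IsCompact K) {ε : ℝ} (hε : 0 < ε) :
    ∀ᶠ F : Finset ℝ in atTop, ∀ x ∈ K, ‖∑ μ ∈ F, spectralProj A μ x - x‖ ≤ ε := by
  -- The partial sums are contractions, so convergence on a finite `ε/3`-net carries over to the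
  -- whole compact set.
  obtain ⟨t, -, ht, hcov⟩ := hK.finite_cover_balls (e := ε / 3) (by positivity)
  have h1 : ∀ᶠ F : Finset ℝ in atTop, ∀ y ∈ t, ‖∑ μ ∈ F, spectralProj A μ y - y‖ ≤ ε / 3 := by
    rw [ht.eventually_all]
    intro y _
    have := (hA.hasSum_spectralProj y).eventually (Metric.closedBall_mem_nhds y
      (show 0 < ε / 3 by positivity))
    filter_upwards [this] with F hF
    rwa [dist_eq_norm] at hF
  filter_upwards [h1] with F hF x hx
  obtain ⟨y, hy, hxy⟩ : ∃ y ∈ t, x ∈ Metric.ball y (ε / 3) := by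
    simpa using hcov hx
  rw [mem_ball_iff_norm] at hxy
  have h2 := hA.norm_sum_spectralProj_le F (x - y)
  have h3 : ∑ μ ∈ F, spectralProj A μ x - x = ∑ μ ∈ F, spectralProj A μ (x - y)
      + (∑ μ ∈ F, spectralProj A μ y - y) - (x - y) := by
    simp only [map_sub, Finset.sum_sub_distrib]
    abel
  rw [h3]
  refine (norm_sub_le _ _).trans ?_
  have h4 := norm_add_le (∑ μ ∈ F, spectralProj A μ (x - y)) (∑ μ ∈ F, spectralProj A μ y - y)
  linarith [hF y hy]

end EnergySum

/-! ### Squared norms of absolutely continuous curves -/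

section AbsolutelyContinuous

theorem _root_.AbsolutelyContinuousOnInterval.of_dist_le {X Y : Type*} [PseudoMetricSpace X]
    [PseudoMetricSpace Y] {f : ℝ → X} {g : ℝ → Y} {a b : ℝ} (C : ℝ)
    (hg : AbsolutelyContinuousOnInterval g a b)
    (h : ∀ x ∈ Set.uIcc a b, ∀ y ∈ Set.uIcc a b, dist (f x) (f y) ≤ C * dist (g x) (g y)) :
    AbsolutelyContinuousOnInterval f a b := by
  have h1 := Tendsto.const_mul C hg
  rw [mul_zero] at h1
  refine squeeze_zero' (Eventually.of_forall fun E => Finset.sum_nonneg fun i _ => dist_nonneg)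
    ?_ h1
  have h2 : ∀ᶠ E in AbsolutelyContinuousOnInterval.totalLengthFilter ⊓
      𝓟 (AbsolutelyContinuousOnInterval.disjWithin a b),
      E ∈ AbsolutelyContinuousOnInterval.disjWithin a b :=
    eventually_inf_principal.mpr (by simp)
  filter_upwards [h2] with E hE
  rw [Finset.mul_sum]
  exact Finset.sum_le_sum fun i hi => h _ (hE.1 i hi).1 _ (hE.1 i hi).2

variable {𝕜 H : Type*} [RCLike 𝕜] [NormedAddCommGroup H] [InnerProductSpace 𝕜 H]

theorem intervalIntegrable_re_inner {f g : ℝ → H} {a b : ℝ}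
    (hf : IntervalIntegrable f volume a b) (hg : ContinuousOn g (Set.uIcc a b)) :
    IntervalIntegrable (fun s => RCLike.re ⟪f s, g s⟫_𝕜) volume a b := by
  refine (hf.norm.mul_continuousOn hg.norm).mono_fun ?_ ?_
  · have h1 := hf.aestronglyMeasurable_restrict_uIoc
    have h2 : AEStronglyMeasurable g (volume.restrict (Set.uIoc a b)) :=
      hg.aestronglyMeasurable_of_subset_isCompact isCompact_uIcc
        measurableSet_uIoc Set.uIoc_subset_uIcc
    exact RCLike.continuous_re.comp_aestronglyMeasurable (h1.inner h2)
  · refine Eventually.of_forall fun s => ?_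
    simp only [norm_mul, norm_norm]
    exact (RCLike.norm_re_le_norm _).trans (norm_inner_le_norm _ _)

variable [CompleteSpace H] [NormedSpace ℝ H]

/-- The source is merely integrable, so velocities are differentiable only almost everywhere. The
fundamental theorem of calculus is applied to the scalar function `‖G‖²`, which is absolutely
continuous. -/
theorem norm_sq_eq_add_integral {g G : ℝ → H} {T : ℝ} (hT : 0 ≤ T)
    (hg : IntervalIntegrable g volume 0 T)
    (hG : ∀ t ∈ Set.Icc 0 T, G t = G 0 + ∫ s in (0 : ℝ)..t, g s) :
    ‖G T‖ ^ 2 = ‖G 0‖ ^ 2 + 2 * ∫ s in (0 : ℝ)..T, RCLike.re ⟪g s, G s⟫_𝕜 := by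
  -- `G` is prescribed on `[0,T]` only; `Γ` extends it to the line, so that two-sided derivatives
  -- make sense.
  set Γ : ℝ → H := fun t => G 0 + ∫ s in (0 : ℝ)..t, g s with hΓ
  have hsub : ∀ x ∈ Set.uIcc 0 T, ∀ y ∈ Set.uIcc 0 T, IntervalIntegrable g volume x y :=
    fun x hx y hy => hg.mono_set (Set.uIcc_subset_uIcc hx hy)
  have h0 : (0 : ℝ) ∈ Set.uIcc 0 T := Set.left_mem_uIcc
  have hN := hg.norm.absolutelyContinuousOnInterval_intervalIntegral h0
  obtain ⟨K, hK⟩ := hN.exists_bound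
  have hK0 : ∀ x ∈ Set.uIcc 0 T, ‖Γ x‖ ≤ ‖G 0‖ + K := fun x hx => by
    refine (norm_add_le _ _).trans (add_le_add_right ?_ _)
    exact (intervalIntegral.norm_integral_le_abs_integral_norm).trans (hK x hx)
  have hdist : ∀ x ∈ Set.uIcc 0 T, ∀ y ∈ Set.uIcc 0 T, ‖Γ x - Γ y‖ ≤
      dist (∫ s in (0 : ℝ)..x, ‖g s‖) (∫ s in (0 : ℝ)..y, ‖g s‖) := fun x hx y hy => by
    have e1 : Γ x - Γ y = ∫ s in y..x, g s := by
      simp only [hΓ]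
      rw [add_sub_add_left_eq_sub, intervalIntegral.integral_interval_sub_left (hsub 0 h0 x hx)
        (hsub 0 h0 y hy)]
    rw [e1, Real.dist_eq, intervalIntegral.integral_interval_sub_left (hsub 0 h0 x hx).norm
        (hsub 0 h0 y hy).norm]
    exact intervalIntegral.norm_integral_le_abs_integral_norm
  -- Increments of `‖Γ‖²` are at most `2 sup ‖Γ‖` times those of the primitive of `‖g‖`, and `‖G 0‖
  -- + K` bounds the supremum.
  have hac : AbsolutelyContinuousOnInterval (fun x => ‖Γ x‖ ^ 2) 0 T := by
    refine AbsolutelyContinuousOnInterval.of_dist_le (2 * (‖G 0‖ + K)) hN fun x hx y hy => ?_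
    have e1 := abs_norm_sub_norm_le (Γ x) (Γ y)
    have e2 : ‖Γ x‖ ^ 2 - ‖Γ y‖ ^ 2 = (‖Γ x‖ + ‖Γ y‖) * (‖Γ x‖ - ‖Γ y‖) := by ring
    rw [Real.dist_eq, e2, abs_mul, abs_of_nonneg (by positivity)]
    refine mul_le_mul ?_ (e1.trans (hdist x hx y hy)) (abs_nonneg _) ?_
    · linarith [hK0 x hx, hK0 y hy]
    · linarith [hK0 x hx, norm_nonneg (Γ x)]
  have hfin := hac.integral_deriv_eq_sub
  have hder : ∫ x in (0 : ℝ)..T, deriv (fun x => ‖Γ x‖ ^ 2) x =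
      ∫ s in (0 : ℝ)..T, 2 * RCLike.re ⟪g s, G s⟫_𝕜 := by
    refine intervalIntegral.integral_congr_ae ?_
    filter_upwards [hg.ae_hasDerivAt_integral] with x hx hx'
    have hx2 : x ∈ Set.uIcc 0 T := Set.uIoc_subset_uIcc hx'
    have hd : HasDerivAt Γ (g x) x := (hx hx2 0 h0).const_add (G 0)
    have hGx : G x = Γ x := hG x (by rwa [Set.uIcc_of_le hT] at hx2)
    have hd2 := (RCLike.reCLM (K := 𝕜)).hasFDerivAt.comp_hasDerivAt x (hd.inner 𝕜 hd)
    have e : (fun x => ‖Γ x‖ ^ 2) = (RCLike.reCLM (K := 𝕜)) ∘ fun t => ⟪Γ t, Γ t⟫_𝕜 := by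
      ext t
      exact (inner_self_eq_norm_sq (𝕜 := 𝕜) (Γ t)).symm
    rw [e, hd2.deriv, hGx, RCLike.reCLM_apply, map_add, inner_re_symm (𝕜 := 𝕜) (Γ x) (g x)]
    ring
  have hGT : G T = Γ T := hG T ⟨hT, le_rfl⟩
  have hG0 : Γ 0 = G 0 := by simp [hΓ]
  rw [hder, intervalIntegral.integral_const_mul, hG0, ← hGT] at hfin
  linarith

end AbsolutelyContinuous

section

/-! ### Square integrable sources -/

section SquareIntegrable

variable {E : Type*} [NormedAddCommGroup E] {T : ℝ} {f : ℝ → E}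

theorem MemL2.integrableOn (hf : MemL2 T f) : IntegrableOn f (Set.Icc 0 T) :=
  MemLp.integrable (q := 2) (by norm_num) hf

theorem MemL2.intervalIntegrable (hf : MemL2 T f) {a b : ℝ} (ha : a ∈ Set.Icc 0 T)
    (hb : b ∈ Set.Icc 0 T) : IntervalIntegrable f volume a b :=
  (hf.integrableOn.mono_set (Set.uIcc_subset_Icc ha hb)).intervalIntegrable

theorem MemL2.intervalIntegrable_norm_sq (hf : MemL2 T f) {a b : ℝ} (ha : a ∈ Set.Icc 0 T)
    (hb : b ∈ Set.Icc 0 T) : IntervalIntegrable (fun t => ‖f t‖ ^ 2) volume a b := by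
  have h : IntegrableOn (fun t => ‖f t‖ ^ 2) (Set.Icc 0 T) :=
    (memLp_two_iff_integrable_sq_norm hf.1).mp hf
  exact (h.mono_set (Set.uIcc_subset_Icc ha hb)).intervalIntegrable

theorem MemL2.comp_add_right (hf : MemL2 T f) {t₀ τ : ℝ} (h0 : 0 ≤ t₀) (hτ : τ + t₀ ≤ T) :
    MemL2 τ fun s => f (s + t₀) := by
  have h1 : MemLp f 2 (volume.restrict (Set.Icc t₀ (τ + t₀))) :=
    hf.mono_measure (Measure.restrict_mono (Set.Icc_subset_Icc h0 hτ) le_rfl)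
  have h2 : MeasurePreserving (fun s : ℝ => s + t₀) (volume.restrict (Set.Icc 0 τ))
      (volume.restrict (Set.Icc t₀ (τ + t₀))) := by
    have := (measurePreserving_add_right volume t₀).restrict_preimage
      (measurableSet_Icc (a := t₀) (b := τ + t₀))
    simpa using this
  exact h1.comp_measurePreserving h2

theorem _root_.ContinuousOn.memL2 (hf : ContinuousOn f (Set.Icc 0 T)) : MemL2 T f := by
  obtain ⟨K, hK⟩ := isCompact_Icc.exists_bound_of_continuousOn hf
  exact MemLp.of_bound (hf.aestronglyMeasurable_of_isCompact isCompact_Icc measurableSet_Icc) K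
    ((ae_restrict_iff' measurableSet_Icc).mpr (Eventually.of_forall hK))

end SquareIntegrable

variable {𝕜 H : Type*} [RCLike 𝕜] [NormedAddCommGroup H] [InnerProductSpace 𝕜 H]
  [CompleteSpace H] [NormedSpace ℝ H] [IsScalarTower ℝ 𝕜 H] {A : H →ₗ.[𝕜] H}

/-! ### The energy identity for mild solutions -/

section EnergyIdentity

variable {T : ℝ} {f w v : ℝ → H}

theorem IsSolution.intervalIntegrable_v (h : IsSolution A T f w v) {a b : ℝ}
    (ha : a ∈ Set.Icc 0 T) (hb : b ∈ Set.Icc 0 T) : IntervalIntegrable v volume a b :=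
  (h.continuous_v.mono (Set.uIcc_subset_Icc ha hb)).intervalIntegrable

theorem IsSolution.continuousOn_w (h : IsSolution A T f w v) : ContinuousOn w (Set.Icc 0 T) := by
  rcases lt_or_ge T 0 with hT | hT
  · simp [Set.Icc_eq_empty hT.not_ge]
  have h1 : ContinuousOn (fun t => w 0 + ∫ s in (0 : ℝ)..t, v s) (Set.Icc 0 T) := by
    refine continuousOn_const.add ?_
    have := intervalIntegral.continuousOn_primitive_interval (f := v) (μ := volume)
      (a := 0) (b := T) (by rw [Set.uIcc_of_le hT]; exact h.continuous_v.integrableOn_Icc)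
    rwa [Set.uIcc_of_le hT] at this
  exact h1.congr h.eq_w

theorem IsSolution.intervalIntegrable_w (h : IsSolution A T f w v) {a b : ℝ}
    (ha : a ∈ Set.Icc 0 T) (hb : b ∈ Set.Icc 0 T) : IntervalIntegrable w volume a b :=
  (h.continuousOn_w.mono (Set.uIcc_subset_Icc ha hb)).intervalIntegrable

/-- The energy identity for a single spectral component. -/
theorem IsSolution.component_energy_eq (hA : IsAdmissibleGenerator A) (hf : MemL2 T f)
    (h : IsSolution A T f w v) (μ : ℝ) {t : ℝ} (ht : t ∈ Set.Icc 0 T) :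
    1 / 2 * (μ * ‖spectralProj A μ (w t)‖ ^ 2 + ‖spectralProj A μ (v t)‖ ^ 2) =
      1 / 2 * (μ * ‖spectralProj A μ (w 0)‖ ^ 2 + ‖spectralProj A μ (v 0)‖ ^ 2) +
        ∫ s in (0 : ℝ)..t, RCLike.re ⟪f s, spectralProj A μ (v s)⟫_𝕜 := by
  set P := spectralProj A μ
  have h0T : (0 : ℝ) ∈ Set.Icc 0 T := ⟨le_rfl, ht.1.trans ht.2⟩
  have hsub : Set.Icc 0 t ⊆ Set.Icc 0 T := Set.Icc_subset_Icc_right ht.2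
  have hIv : ∀ s ∈ Set.Icc 0 t, IntervalIntegrable v volume 0 s :=
    fun s hs => h.intervalIntegrable_v h0T (hsub hs)
  have hIw : ∀ s ∈ Set.Icc 0 t, IntervalIntegrable w volume 0 s :=
    fun s hs => h.intervalIntegrable_w h0T (hsub hs)
  have hIf : ∀ s ∈ Set.Icc 0 t, IntervalIntegrable f volume 0 s :=
    fun s hs => hf.intervalIntegrable h0T (hsub hs)
  have hP : ∀ {g : ℝ → H} {s : ℝ}, IntervalIntegrable g volume 0 s →
      IntervalIntegrable (fun r => P (g r)) volume 0 s := fun {g s} hg =>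
    ⟨P.integrable_comp hg.1, P.integrable_comp hg.2⟩
  have hμP : ∀ {g : ℝ → H} {s : ℝ}, IntervalIntegrable g volume 0 s →
      IntervalIntegrable (fun r => μ • P (g r)) volume 0 s := fun hg => (hP hg).smul μ
  have htt : t ∈ Set.Icc 0 t := ⟨ht.1, le_rfl⟩
  -- After projection the equation is `(Pw)' = Pv`, `(Pv)' = Pf - μ Pw` with a bounded coefficient.
  -- The terms `μ Re⟪Pv, Pw⟫` in the two squared norms then cancel.
  have e1 : ∀ s ∈ Set.Icc 0 t, P (w s) = P (w 0) + ∫ r in (0 : ℝ)..s, P (v r) := fun s hs => by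
    rw [h.eq_w s (hsub hs), map_add, P.intervalIntegral_comp_comm (hIv s hs)]
  have e2 : ∀ s ∈ Set.Icc 0 t, P (v s) = P (v 0) +
      ∫ r in (0 : ℝ)..s, (P (f r) - μ • P (w r)) := fun s hs => by
    obtain ⟨hd, hv⟩ := h.eq_v s (hsub hs)
    rw [hv, map_add, map_sub, hA.spectralProj_apply, intervalIntegral.integral_sub
      (hP (hIf s hs)) (hμP (hIw s hs)), P.intervalIntegral_comp_comm (hIf s hs),
      intervalIntegral.integral_smul, P.intervalIntegral_comp_comm (hIw s hs),
      RCLike.real_smul_eq_coe_smul (K := 𝕜)]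
    abel
  have hPv : ContinuousOn (fun s => P (v s)) (Set.uIcc 0 t) := by
    rw [Set.uIcc_of_le ht.1]
    exact P.continuous.comp_continuousOn (h.continuous_v.mono hsub)
  have hPw : ContinuousOn (fun s => P (w s)) (Set.uIcc 0 t) := by
    rw [Set.uIcc_of_le ht.1]
    exact P.continuous.comp_continuousOn (h.continuousOn_w.mono hsub)
  have n1 := norm_sq_eq_add_integral (𝕜 := 𝕜) ht.1 (hP (hIv t htt)) e1
  have n2 := norm_sq_eq_add_integral (𝕜 := 𝕜) ht.1
    ((hP (hIf t htt)).sub (hμP (hIw t htt))) e2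
  have i1 := intervalIntegrable_re_inner (𝕜 := 𝕜) (hP (hIf t htt)) hPv
  have i2 := intervalIntegrable_re_inner (𝕜 := 𝕜) (hP (hIv t htt)) hPw
  have n3 : ∫ s in (0 : ℝ)..t, RCLike.re ⟪P (f s) - μ • P (w s), P (v s)⟫_𝕜 =
      (∫ s in (0 : ℝ)..t, RCLike.re ⟪f s, P (v s)⟫_𝕜) -
        μ * ∫ s in (0 : ℝ)..t, RCLike.re ⟪P (v s), P (w s)⟫_𝕜 := by
    rw [← intervalIntegral.integral_const_mul]
    have : ∀ s, RCLike.re ⟪f s, P (v s)⟫_𝕜 = RCLike.re ⟪P (f s), P (v s)⟫_𝕜 := fun s => by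
      rw [inner_spectralProj_left, spectralProj_of_mem (hA.spectralProj_mem μ (v s))]
    simp_rw [this]
    rw [← intervalIntegral.integral_sub i1 (i2.const_mul μ)]
    refine intervalIntegral.integral_congr fun s _ => ?_
    rw [inner_sub_left, map_sub, RCLike.real_smul_eq_coe_smul (K := 𝕜), inner_smul_left,
      RCLike.conj_ofReal, RCLike.re_ofReal_mul, inner_re_symm (P (w s))]
  rw [n3] at n2
  rw [n1, n2]
  ring

/-- The energy identity for mild solutions. -/
theorem IsSolution.energy_eq (hA : IsAdmissibleGenerator A) (hf : MemL2 T f)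
    (h : IsSolution A T f w v) {t : ℝ} (ht : t ∈ Set.Icc 0 T) :
    energy A 1 (w t) (v t) = energy A 1 (w 0) (v 0) +
      ∫ s in (0 : ℝ)..t, RCLike.re ⟪f s, v s⟫_𝕜 := by
  have h0T : (0 : ℝ) ∈ Set.Icc 0 T := ⟨le_rfl, ht.1.trans ht.2⟩
  have hsub : Set.Icc 0 t ⊆ Set.Icc 0 T := Set.Icc_subset_Icc_right ht.2
  have hIf := hf.intervalIntegrable h0T ht
  have hcv : ContinuousOn v (Set.uIcc 0 t) := by
    rw [Set.uIcc_of_le ht.1]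
    exact h.continuous_v.mono hsub
  have hcP : ∀ μ, ContinuousOn (fun s => spectralProj A μ (v s)) (Set.uIcc 0 t) :=
    fun μ => (spectralProj A μ).continuous.comp_continuousOn hcv
  have t1 : Tendsto (fun F : Finset ℝ =>
      ∑ μ ∈ F, 1 / 2 * (μ * ‖spectralProj A μ (w t)‖ ^ 2 + ‖spectralProj A μ (v t)‖ ^ 2)) atTop
      (𝓝 (energy A 1 (w t) (v t))) := hA.hasSum_energy (h.mem_H1 t ht) (v t)
  have t2 : Tendsto (fun F : Finset ℝ =>
      ∑ μ ∈ F, 1 / 2 * (μ * ‖spectralProj A μ (w 0)‖ ^ 2 + ‖spectralProj A μ (v 0)‖ ^ 2)) atTop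
      (𝓝 (energy A 1 (w 0) (v 0))) := hA.hasSum_energy (h.mem_H1 0 h0T) (v 0)
  have t3 : Tendsto (fun F : Finset ℝ => ∑ μ ∈ F,
      ∫ s in (0 : ℝ)..t, RCLike.re ⟪f s, spectralProj A μ (v s)⟫_𝕜) atTop
      (𝓝 (∫ s in (0 : ℝ)..t, RCLike.re ⟪f s, v s⟫_𝕜)) := by
    rw [Metric.tendsto_nhds]
    intro ε hε
    set N := ∫ s in (0 : ℝ)..t, ‖f s‖
    have hN : 0 ≤ N := intervalIntegral.integral_nonneg ht.1 fun s _ => norm_nonneg _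
    have hK : IsCompact (v '' Set.Icc 0 t) :=
      isCompact_Icc.image_of_continuousOn (h.continuous_v.mono hsub)
    -- The velocities on `[0,t]` form a compact set, so their partial spectral sums converge
    -- uniformly in time, and integrability of `f` is enough to pass to the limit. The `+ 1` covers
    -- the case `N = 0`.
    filter_upwards [hA.eventually_norm_sum_sub_le hK (show 0 < ε / (N + 1) by positivity)]
      with F hF
    have e1 : ∑ μ ∈ F, ∫ s in (0 : ℝ)..t, RCLike.re ⟪f s, spectralProj A μ (v s)⟫_𝕜 =
        ∫ s in (0 : ℝ)..t, ∑ μ ∈ F, RCLike.re ⟪f s, spectralProj A μ (v s)⟫_𝕜 :=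
      (intervalIntegral.integral_finsetSum fun μ _ =>
        intervalIntegrable_re_inner hIf (hcP μ)).symm
    have i1 : IntervalIntegrable (fun s => ∑ μ ∈ F,
        RCLike.re ⟪f s, spectralProj A μ (v s)⟫_𝕜) volume 0 t := by
      simpa only [Finset.sum_fn] using IntervalIntegrable.sum F fun μ _ =>
        intervalIntegrable_re_inner (𝕜 := 𝕜) hIf (hcP μ)
    rw [e1, Real.dist_eq, ← intervalIntegral.integral_sub i1 (intervalIntegrable_re_inner hIf hcv),
      ← Real.norm_eq_abs]
    have e2 : ‖∫ s in (0 : ℝ)..t, (∑ μ ∈ F, RCLike.re ⟪f s, spectralProj A μ (v s)⟫_𝕜 -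
        RCLike.re ⟪f s, v s⟫_𝕜)‖ ≤ ∫ s in (0 : ℝ)..t, ‖f s‖ * (ε / (N + 1)) := by
      refine intervalIntegral.norm_integral_le_of_norm_le ht.1 ?_ (hIf.norm.mul_const _)
      refine Eventually.of_forall fun s hs => ?_
      rw [← map_sum, ← map_sub, ← inner_sum, ← inner_sub_right]
      refine (RCLike.norm_re_le_norm _).trans ((norm_inner_le_norm _ _).trans ?_)
      gcongr
      exact hF _ ⟨s, Set.Ioc_subset_Icc_self hs, rfl⟩
    refine e2.trans_lt ?_
    rw [intervalIntegral.integral_mul_const, mul_div_assoc', div_lt_iff₀ (by positivity)]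
    change N * ε < _
    nlinarith
  refine tendsto_nhds_unique t1 ?_
  refine (t2.add t3).congr fun F => ?_
  rw [← Finset.sum_add_distrib]
  exact Finset.sum_congr rfl fun μ _ => (h.component_energy_eq hA hf μ ht).symm

theorem IsSolution.energy_const (hA : IsAdmissibleGenerator A)
    (h : IsSolution A T (fun _ => 0) w v) {t : ℝ} (ht : t ∈ Set.Icc 0 T) :
    energy A 1 (w t) (v t) = energy A 1 (w 0) (v 0) := by
  rw [h.energy_eq hA continuousOn_const.memL2 ht]
  simp

theorem IsSolution.continuousOn_energy (hA : IsAdmissibleGenerator A) (hf : MemL2 T f)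
    (h : IsSolution A T f w v) :
    ContinuousOn (fun t => energy A 1 (w t) (v t)) (Set.Icc 0 T) := by
  rcases lt_or_ge T 0 with hT | hT
  · simp [Set.Icc_eq_empty hT.not_ge]
  have h0T : (0 : ℝ) ∈ Set.Icc 0 T := ⟨le_rfl, hT⟩
  have hTT : T ∈ Set.Icc 0 T := ⟨hT, le_rfl⟩
  have h1 : ContinuousOn (fun t => energy A 1 (w 0) (v 0) +
      ∫ s in (0 : ℝ)..t, RCLike.re ⟪f s, v s⟫_𝕜) (Set.Icc 0 T) := by
    refine continuousOn_const.add ?_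
    have hi : IntervalIntegrable (fun s => RCLike.re ⟪f s, v s⟫_𝕜) volume 0 T :=
      intervalIntegrable_re_inner (hf.intervalIntegrable h0T hTT)
        (by rw [Set.uIcc_of_le hT]; exact h.continuous_v)
    have := intervalIntegral.continuousOn_primitive_interval' hi (a := 0) Set.left_mem_uIcc
    rwa [Set.uIcc_of_le hT] at this
  exact h1.congr fun t ht => h.energy_eq hA hf ht

theorem IsSolution.intervalIntegrable_energy (hA : IsAdmissibleGenerator A) (hf : MemL2 T f)
    (h : IsSolution A T f w v) {a b : ℝ} (ha : a ∈ Set.Icc 0 T) (hb : b ∈ Set.Icc 0 T) :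
    IntervalIntegrable (fun t => energy A 1 (w t) (v t)) volume a b :=
  ((h.continuousOn_energy hA hf).mono (Set.uIcc_subset_Icc ha hb)).intervalIntegrable

end EnergyIdentity

/-! ### Negatives, sums and time translates of solutions -/

section Operations

variable {T : ℝ} {f w v f₁ w₁ v₁ f₂ w₂ v₂ : ℝ → H}

theorem IsSolution.neg (h : IsSolution A T f w v) :
    IsSolution A T (fun t => -f t) (fun t => -w t) (fun t => -v t) where
  mem_H1 t ht := memH_neg (h.mem_H1 t ht)
  continuous_w t ht := by
    refine (h.continuous_w t ht).congr fun s => ?_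
    rw [← normSq_neg, neg_sub, neg_sub_neg]
  continuous_v := h.continuous_v.neg
  eq_w t ht := by rw [h.eq_w t ht, intervalIntegral.integral_neg, neg_add]
  eq_v t ht := by
    obtain ⟨hd, hv⟩ := h.eq_v t ht
    have e : ∫ s in (0 : ℝ)..t, -w s = -∫ s in (0 : ℝ)..t, w s := intervalIntegral.integral_neg
    have hd' : ∫ s in (0 : ℝ)..t, -w s ∈ A.domain := by rw [e]; exact A.domain.neg_mem hd
    refine ⟨hd', ?_⟩
    have : (⟨_, hd'⟩ : A.domain) = -⟨_, hd⟩ := Subtype.ext e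
    rw [this, LinearPMap.map_neg, hv, intervalIntegral.integral_neg]
    abel

theorem IsSolution.add (hA : IsAdmissibleGenerator A) (hf₁ : MemL2 T f₁) (hf₂ : MemL2 T f₂)
    (h₁ : IsSolution A T f₁ w₁ v₁) (h₂ : IsSolution A T f₂ w₂ v₂) :
    IsSolution A T (fun t => f₁ t + f₂ t) (fun t => w₁ t + w₂ t) (fun t => v₁ t + v₂ t) where
  mem_H1 t ht := hA.memH_add (h₁.mem_H1 t ht) (h₂.mem_H1 t ht)
  continuous_w t ht := by
    have := ENNReal.Tendsto.const_mul (a := 2) ((h₁.continuous_w t ht).add (h₂.continuous_w t ht))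
      (Or.inr (by norm_num))
    rw [add_zero, mul_zero] at this
    refine tendsto_of_tendsto_of_tendsto_of_le_of_le tendsto_const_nhds this
      (fun _ => zero_le) fun s => ?_
    simp only
    rw [add_sub_add_comm]
    exact hA.normSq_one_add_le _ _
  continuous_v := h₁.continuous_v.add h₂.continuous_v
  eq_w t ht := by
    have h0T : (0 : ℝ) ∈ Set.Icc 0 T := ⟨le_rfl, ht.1.trans ht.2⟩
    rw [h₁.eq_w t ht, h₂.eq_w t ht, intervalIntegral.integral_add
      (h₁.intervalIntegrable_v h0T ht) (h₂.intervalIntegrable_v h0T ht)]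
    abel
  eq_v t ht := by
    have h0T : (0 : ℝ) ∈ Set.Icc 0 T := ⟨le_rfl, ht.1.trans ht.2⟩
    obtain ⟨hd₁, hv₁⟩ := h₁.eq_v t ht
    obtain ⟨hd₂, hv₂⟩ := h₂.eq_v t ht
    have e : ∫ s in (0 : ℝ)..t, (w₁ s + w₂ s) =
        (∫ s in (0 : ℝ)..t, w₁ s) + ∫ s in (0 : ℝ)..t, w₂ s :=
      intervalIntegral.integral_add (h₁.intervalIntegrable_w h0T ht)
        (h₂.intervalIntegrable_w h0T ht)
    have hd : ∫ s in (0 : ℝ)..t, (w₁ s + w₂ s) ∈ A.domain := by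
      rw [e]; exact A.domain.add_mem hd₁ hd₂
    refine ⟨hd, ?_⟩
    have : (⟨_, hd⟩ : A.domain) = ⟨_, hd₁⟩ + ⟨_, hd₂⟩ := Subtype.ext e
    rw [this, LinearPMap.map_add, hv₁, hv₂, intervalIntegral.integral_add
      (hf₁.intervalIntegrable h0T ht) (hf₂.intervalIntegrable h0T ht)]
    abel

theorem integral_comp_add_right_eq_sub {E : Type*} [NormedAddCommGroup E] [NormedSpace ℝ E]
    {g : ℝ → E} {t t₀ : ℝ} (h1 : IntervalIntegrable g volume 0 (t + t₀))
    (h2 : IntervalIntegrable g volume 0 t₀) :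
    ∫ s in (0 : ℝ)..t, g (s + t₀) =
      (∫ s in (0 : ℝ)..(t + t₀), g s) - ∫ s in (0 : ℝ)..t₀, g s := by
  rw [intervalIntegral.integral_comp_add_right, zero_add,
    intervalIntegral.integral_interval_sub_left h1 h2]

theorem IsSolution.shift (hf : MemL2 T f) (h : IsSolution A T f w v) {t₀ τ : ℝ}
    (h0 : 0 ≤ t₀) (hτ : τ + t₀ ≤ T) :
    IsSolution A τ (fun s => f (s + t₀)) (fun s => w (s + t₀)) (fun s => v (s + t₀)) := by
  have hmem : ∀ t ∈ Set.Icc 0 τ, t + t₀ ∈ Set.Icc 0 T := fun t ht =>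
    ⟨add_nonneg ht.1 h0, by linarith [ht.2]⟩
  have h0T : ∀ t ∈ Set.Icc 0 τ, (0 : ℝ) ∈ Set.Icc 0 T := fun t ht =>
    ⟨le_rfl, (hmem t ht).1.trans (hmem t ht).2⟩
  have ht0 : ∀ t ∈ Set.Icc 0 τ, t₀ ∈ Set.Icc 0 T := fun t ht => ⟨h0, by linarith [ht.1, ht.2]⟩
  have hmaps : ∀ t ∈ Set.Icc 0 τ, Tendsto (fun s => s + t₀) (𝓝[Set.Icc 0 τ] t)
      (𝓝[Set.Icc 0 T] (t + t₀)) := fun t ht =>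
    (continuous_id.add continuous_const).continuousWithinAt.tendsto_nhdsWithin hmem
  refine ⟨fun t ht => h.mem_H1 _ (hmem t ht),
    fun t ht => (h.continuous_w _ (hmem t ht)).comp (hmaps t ht),
    h.continuous_v.comp (by fun_prop) hmem, fun t ht => ?_, fun t ht => ?_⟩
  · rw [integral_comp_add_right_eq_sub (h.intervalIntegrable_v (h0T t ht) (hmem t ht))
      (h.intervalIntegrable_v (h0T t ht) (ht0 t ht)), zero_add, h.eq_w _ (hmem t ht),
      h.eq_w _ (ht0 t ht)]
    abel
  · obtain ⟨hd₁, hv₁⟩ := h.eq_v _ (hmem t ht)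
    obtain ⟨hd₂, hv₂⟩ := h.eq_v _ (ht0 t ht)
    have e := integral_comp_add_right_eq_sub (h.intervalIntegrable_w (h0T t ht) (hmem t ht))
      (h.intervalIntegrable_w (h0T t ht) (ht0 t ht))
    have hd : ∫ s in (0 : ℝ)..t, w (s + t₀) ∈ A.domain := by
      rw [e]; exact A.domain.sub_mem hd₁ hd₂
    refine ⟨hd, ?_⟩
    -- The integrated equation on `[0, t]` for the translate is the difference of the original ones
    -- at `t + t₀` and `t₀`.
    have : (⟨_, hd⟩ : A.domain) = ⟨_, hd₁⟩ - ⟨_, hd₂⟩ := Subtype.ext e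
    rw [this, LinearPMap.map_sub, zero_add, hv₁, hv₂,
      integral_comp_add_right_eq_sub (hf.intervalIntegrable (h0T t ht) (hmem t ht))
      (hf.intervalIntegrable (h0T t ht) (ht0 t ht))]
    abel

end Operations

end

section

variable {𝕜 H : Type*} [RCLike 𝕜] [NormedAddCommGroup H] [InnerProductSpace 𝕜 H]
  [CompleteSpace H] [NormedSpace ℝ H] [IsScalarTower ℝ 𝕜 H] {A : H →ₗ.[𝕜] H}

/-! ### Existence for the free equation -/

section FreeEvolution

/-- A component of the position `cos(t √A) w₀ + A^{-1/2} sin(t √A) v₀`. -/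
def freePosition (A : H →ₗ.[𝕜] H) (w₀ v₀ : H) (t μ : ℝ) : H :=
  Real.cos (√μ * t) • spectralProj A μ w₀ + (Real.sin (√μ * t) / √μ) • spectralProj A μ v₀

/-- A component of the velocity `-A^{1/2} sin(t √A) w₀ + cos(t √A) v₀`. -/
def freeVelocity (A : H →ₗ.[𝕜] H) (w₀ v₀ : H) (t μ : ℝ) : H :=
  (-(√μ * Real.sin (√μ * t))) • spectralProj A μ w₀ + Real.cos (√μ * t) • spectralProj A μ v₀

theorem IsAdmissibleGenerator.freePosition_mem (hA : IsAdmissibleGenerator A) (w₀ v₀ : H)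
    (t μ : ℝ) : freePosition A w₀ v₀ t μ ∈ eigenspace A μ :=
  Submodule.add_mem _ (Submodule.smul_of_tower_mem _ _ (hA.spectralProj_mem μ _))
    (Submodule.smul_of_tower_mem _ _ (hA.spectralProj_mem μ _))

theorem IsAdmissibleGenerator.freeVelocity_mem (hA : IsAdmissibleGenerator A) (w₀ v₀ : H)
    (t μ : ℝ) : freeVelocity A w₀ v₀ t μ ∈ eigenspace A μ :=
  Submodule.add_mem _ (Submodule.smul_of_tower_mem _ _ (hA.spectralProj_mem μ _))
    (Submodule.smul_of_tower_mem _ _ (hA.spectralProj_mem μ _))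

theorem IsAdmissibleGenerator.freePosition_of_nonpos (hA : IsAdmissibleGenerator A) (w₀ v₀ : H)
    (t : ℝ) {μ : ℝ} (hμ : μ ≤ 0) : freePosition A w₀ v₀ t μ = 0 := by
  simp [freePosition, hA.spectralProj_eq_zero hμ]

theorem IsAdmissibleGenerator.freeVelocity_of_nonpos (hA : IsAdmissibleGenerator A) (w₀ v₀ : H)
    (t : ℝ) {μ : ℝ} (hμ : μ ≤ 0) : freeVelocity A w₀ v₀ t μ = 0 := by
  simp [freeVelocity, hA.spectralProj_eq_zero hμ]

theorem IsAdmissibleGenerator.hasDerivAt_freePosition (hA : IsAdmissibleGenerator A) (w₀ v₀ : H)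
    (t μ : ℝ) : HasDerivAt (fun s => freePosition A w₀ v₀ s μ) (freeVelocity A w₀ v₀ t μ) t := by
  rcases le_or_gt μ 0 with hμ | hμ
  · simp only [hA.freePosition_of_nonpos _ _ _ hμ, hA.freeVelocity_of_nonpos _ _ _ hμ]
    exact hasDerivAt_const _ _
  have hs : √μ ≠ 0 := (Real.sqrt_pos.mpr hμ).ne'
  have h0 : HasDerivAt (fun s : ℝ => √μ * s) √μ t := by
    simpa using (hasDerivAt_id t).const_mul √μ
  have h1 := (h0.cos).smul_const (spectralProj A μ w₀)
  have h2 := (h0.sin.div_const √μ).smul_const (spectralProj A μ v₀)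
  refine (h1.add h2).congr_deriv ?_
  rw [freeVelocity, mul_div_cancel_right₀ _ hs]
  congr 2
  ring

theorem IsAdmissibleGenerator.hasDerivAt_freeVelocity (hA : IsAdmissibleGenerator A) (w₀ v₀ : H)
    (t μ : ℝ) :
    HasDerivAt (fun s => freeVelocity A w₀ v₀ s μ) (-(μ • freePosition A w₀ v₀ t μ)) t := by
  rcases le_or_gt μ 0 with hμ | hμ
  · simp only [hA.freePosition_of_nonpos _ _ _ hμ, hA.freeVelocity_of_nonpos _ _ _ hμ, smul_zero,
      neg_zero]
    exact hasDerivAt_const _ _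
  have hs : √μ ≠ 0 := (Real.sqrt_pos.mpr hμ).ne'
  have hsq : √μ * √μ = μ := Real.mul_self_sqrt hμ.le
  have h0 : HasDerivAt (fun s : ℝ => √μ * s) √μ t := by
    simpa using (hasDerivAt_id t).const_mul √μ
  have h1 := ((h0.sin.const_mul √μ).neg).smul_const (spectralProj A μ w₀)
  have h2 := (h0.cos).smul_const (spectralProj A μ v₀)
  refine (h1.add h2).congr_deriv ?_
  rw [freePosition, smul_add, neg_add, smul_smul, smul_smul, ← neg_smul, ← neg_smul]
  congr 2
  · linear_combination (-Real.cos (√μ * t)) * hsq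
  · have h5 : μ / √μ = √μ := Real.div_sqrt
    linear_combination Real.sin (√μ * t) * h5

theorem IsAdmissibleGenerator.norm_freeVelocity_sq_le (hA : IsAdmissibleGenerator A) (w₀ v₀ : H)
    (t μ : ℝ) : ‖freeVelocity A w₀ v₀ t μ‖ ^ 2 ≤
      2 * (μ * ‖spectralProj A μ w₀‖ ^ 2 + ‖spectralProj A μ v₀‖ ^ 2) := by
  rcases le_or_gt μ 0 with hμ | hμ
  · simp [hA.freeVelocity_of_nonpos _ _ _ hμ, hA.spectralProj_eq_zero hμ]
  refine (norm_add_sq_le_of_pos one_pos _ _).trans ?_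
  rw [norm_smul, norm_smul, mul_pow, mul_pow, Real.norm_eq_abs, Real.norm_eq_abs, sq_abs, sq_abs]
  have h1 : (-(√μ * Real.sin (√μ * t))) ^ 2 ≤ μ := by
    rw [neg_sq, mul_pow, Real.sq_sqrt hμ.le]
    nlinarith [Real.sin_sq_le_one (√μ * t)]
  have h2 := Real.cos_sq_le_one (√μ * t)
  have h3 := mul_le_mul_of_nonneg_right h1 (sq_nonneg ‖spectralProj A μ w₀‖)
  have h4 := mul_le_mul_of_nonneg_right h2 (sq_nonneg ‖spectralProj A μ v₀‖)
  linarith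

/-- The bound does not depend on `t`: it serves as the dominating series both for `w t ∈ H₁` and for
continuity in `H₁`. -/
theorem IsAdmissibleGenerator.mul_norm_freePosition_sq_le (hA : IsAdmissibleGenerator A)
    (w₀ v₀ : H) (t μ : ℝ) : μ * ‖freePosition A w₀ v₀ t μ‖ ^ 2 ≤
      2 * (μ * ‖spectralProj A μ w₀‖ ^ 2 + ‖spectralProj A μ v₀‖ ^ 2) := by
  rcases le_or_gt μ 0 with hμ | hμ
  · simp [hA.freePosition_of_nonpos _ _ _ hμ, hA.spectralProj_eq_zero hμ]
  refine (mul_le_mul_of_nonneg_left (norm_add_sq_le_of_pos one_pos _ _) hμ.le).trans ?_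
  rw [norm_smul, norm_smul, mul_pow, mul_pow, Real.norm_eq_abs, Real.norm_eq_abs, sq_abs, sq_abs,
    div_pow, Real.sq_sqrt hμ.le]
  have h1 := mul_le_mul_of_nonneg_right (Real.sin_sq_le_one (√μ * t))
    (sq_nonneg ‖spectralProj A μ v₀‖)
  have h3 := mul_le_mul_of_nonneg_left (mul_le_mul_of_nonneg_right (Real.cos_sq_le_one (√μ * t))
    (sq_nonneg ‖spectralProj A μ w₀‖)) hμ.le
  have h4 : μ * (Real.sin (√μ * t) ^ 2 / μ * ‖spectralProj A μ v₀‖ ^ 2) =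
    Real.sin (√μ * t) ^ 2 * ‖spectralProj A μ v₀‖ ^ 2 := by field_simp
  linarith

/-- From `|sin x| ≤ |x|`, the factor `sin(√μ t)/√μ` is at most `|t|`, so summability in `H` needs no
lower bound on the spectrum. -/
theorem IsAdmissibleGenerator.norm_freePosition_sq_le (hA : IsAdmissibleGenerator A)
    (w₀ v₀ : H) (t μ : ℝ) : ‖freePosition A w₀ v₀ t μ‖ ^ 2 ≤
      2 * (‖spectralProj A μ w₀‖ ^ 2 + t ^ 2 * ‖spectralProj A μ v₀‖ ^ 2) := by
  rcases le_or_gt μ 0 with hμ | hμ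
  · simp [hA.freePosition_of_nonpos _ _ _ hμ, hA.spectralProj_eq_zero hμ]
  refine (norm_add_sq_le_of_pos one_pos _ _).trans ?_
  rw [norm_smul, norm_smul, mul_pow, mul_pow, Real.norm_eq_abs, Real.norm_eq_abs, sq_abs, sq_abs]
  have h1 : (Real.sin (√μ * t) / √μ) ^ 2 ≤ t ^ 2 := by
    rw [div_pow, Real.sq_sqrt hμ.le, div_le_iff₀ hμ]
    have h5 : Real.sin (√μ * t) ^ 2 ≤ (√μ * t) ^ 2 := sq_le_sq.mpr Real.abs_sin_le_abs
    rw [mul_pow, Real.sq_sqrt hμ.le] at h5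
    linarith
  have h3 := mul_le_mul_of_nonneg_right (Real.cos_sq_le_one (√μ * t))
    (sq_nonneg ‖spectralProj A μ w₀‖)
  have h4 := mul_le_mul_of_nonneg_right h1 (sq_nonneg ‖spectralProj A μ v₀‖)
  linarith

theorem norm_sub_sq_le_two (x y : H) : ‖x - y‖ ^ 2 ≤ 2 * (‖x‖ ^ 2 + ‖y‖ ^ 2) := by
  have := norm_add_sq_le_of_pos one_pos x (-y)
  rw [norm_neg, ← sub_eq_add_neg] at this
  linarith

/-- The free equation is solvable for all data in `H₁ × H`. -/
theorem IsAdmissibleGenerator.exists_free_solution (hA : IsAdmissibleGenerator A) (T : ℝ)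
    {w₀ : H} (hw₀ : MemH A 1 w₀) (v₀ : H) :
    ∃ w v : ℝ → H, IsSolution A T (fun _ => 0) w v ∧ w 0 = w₀ ∧ v 0 = v₀ := by
  have hB : Summable fun μ : ℝ => μ * ‖spectralProj A μ w₀‖ ^ 2 + ‖spectralProj A μ v₀‖ ^ 2 := by
    refine Summable.add ?_ (hA.hasSum_norm_sq v₀).summable
    simpa using hA.memH_iff.mp hw₀
  have hW : ∀ t, ∃ x, ∀ μ, spectralProj A μ x = freePosition A w₀ v₀ t μ := fun t => by
    have hs : Summable fun μ => ‖freePosition A w₀ v₀ t μ‖ ^ 2 :=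
      Summable.of_nonneg_of_le (fun μ => by positivity) (hA.norm_freePosition_sq_le w₀ v₀ t)
        (((hA.hasSum_norm_sq w₀).summable.add
          ((hA.hasSum_norm_sq v₀).summable.mul_left _)).mul_left _)
    obtain ⟨x, -, hx⟩ := hA.exists_of_components (hA.freePosition_mem w₀ v₀ t) hs
    exact ⟨x, hx⟩
  have hV : ∀ t, ∃ x, ∀ μ, spectralProj A μ x = freeVelocity A w₀ v₀ t μ := fun t => by
    have hs : Summable fun μ => ‖freeVelocity A w₀ v₀ t μ‖ ^ 2 :=
      Summable.of_nonneg_of_le (fun μ => by positivity) (hA.norm_freeVelocity_sq_le w₀ v₀ t)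
        (hB.mul_left _)
    obtain ⟨x, -, hx⟩ := hA.exists_of_components (hA.freeVelocity_mem w₀ v₀ t) hs
    exact ⟨x, hx⟩
  choose w hw using hW
  choose v hv using hV
  have hcV : ∀ μ, Continuous fun s => freeVelocity A w₀ v₀ s μ := fun μ => by
    unfold freeVelocity
    fun_prop
  have hcW : ∀ μ, Continuous fun s => freePosition A w₀ v₀ s μ := fun μ => by
    unfold freePosition
    fun_prop
  have hvc : Continuous v := by
    refine continuous_iff_continuousAt.mpr fun t => ?_
    rw [ContinuousAt, tendsto_iff_norm_sub_tendsto_zero]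
    have h1 : Tendsto (fun s => ∑' μ, ‖freeVelocity A w₀ v₀ s μ - freeVelocity A w₀ v₀ t μ‖ ^ 2)
        (𝓝 t) (𝓝 (∑' _ : ℝ, (0 : ℝ))) := by
      -- Each of the two velocities contributes `2` times the data, doubled once for each in `‖x -
      -- y‖² ≤ 2(‖x‖² + ‖y‖²)`: in total `8`.
      refine tendsto_tsum_of_dominated_convergence (hB.mul_left 8) (fun μ => ?_)
        (Eventually.of_forall fun s μ => ?_)
      · have := (((hcV μ).tendsto t).sub_const (freeVelocity A w₀ v₀ t μ)).norm.pow 2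
        simpa using this
      · rw [Real.norm_of_nonneg (by positivity)]
        have := norm_sub_sq_le_two (freeVelocity A w₀ v₀ s μ) (freeVelocity A w₀ v₀ t μ)
        linarith [hA.norm_freeVelocity_sq_le w₀ v₀ s μ, hA.norm_freeVelocity_sq_le w₀ v₀ t μ]
    rw [tsum_zero] at h1
    have h2 : ∀ s, ∑' μ, ‖freeVelocity A w₀ v₀ s μ - freeVelocity A w₀ v₀ t μ‖ ^ 2 =
        ‖v s - v t‖ ^ 2 := fun s => by
      rw [← (hA.hasSum_norm_sq (v s - v t)).tsum_eq]
      exact tsum_congr fun μ => by rw [map_sub, hv, hv]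
    simp_rw [h2] at h1
    have h3 := h1.sqrt
    simpa [Real.sqrt_sq] using h3
  have hmem : ∀ t, MemH A 1 (w t) := fun t => by
    rw [hA.memH_iff]
    simp only [zpow_one, hw]
    refine Summable.of_nonneg_of_le (fun μ => ?_) (hA.mul_norm_freePosition_sq_le w₀ v₀ t)
      (hB.mul_left 2)
    rw [← hw]
    exact hA.mul_norm_sq_nonneg _ _
  have hPv : ∀ t μ, spectralProj A μ (∫ s in (0 : ℝ)..t, v s) =
      freePosition A w₀ v₀ t μ - freePosition A w₀ v₀ 0 μ := fun t μ => by
    rw [← ContinuousLinearMap.intervalIntegral_comp_comm _ (hvc.intervalIntegrable _ _)]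
    simp_rw [hv]
    exact intervalIntegral.integral_eq_sub_of_hasDerivAt
      (fun s _ => hA.hasDerivAt_freePosition w₀ v₀ s μ) ((hcV μ).intervalIntegrable _ _)
  have heqw : ∀ t, w t = w 0 + ∫ s in (0 : ℝ)..t, v s := fun t => by
    refine hA.eq_of_spectralProj fun μ => ?_
    rw [map_add, hPv, hw, hw]
    abel
  have hwc : Continuous w := by
    rw [funext heqw]
    exact continuous_const.add (intervalIntegral.continuous_primitive
      (fun a b => hvc.intervalIntegrable a b) 0)
  have hPw : ∀ t μ, spectralProj A μ (v 0 - v t) =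
      (μ : 𝕜) • spectralProj A μ (∫ s in (0 : ℝ)..t, w s) := fun t μ => by
    rw [← ContinuousLinearMap.intervalIntegral_comp_comm _ (hwc.intervalIntegrable _ _)]
    simp_rw [hw]
    have h1 := intervalIntegral.integral_eq_sub_of_hasDerivAt
      (fun s (_ : s ∈ Set.uIcc 0 t) => hA.hasDerivAt_freeVelocity w₀ v₀ s μ)
      ((((hcW μ).const_smul μ).neg).intervalIntegrable _ _)
    rw [intervalIntegral.integral_neg, intervalIntegral.integral_smul,
      RCLike.real_smul_eq_coe_smul (K := 𝕜)] at h1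
    rw [map_sub, hv, hv, ← neg_sub, ← h1, neg_neg]
  refine ⟨w, v, ⟨fun t _ => hmem t, fun t _ => ?_, hvc.continuousOn, fun t _ => heqw t,
    fun t _ => ?_⟩, ?_, ?_⟩
  · refine Tendsto.mono_left ?_ nhdsWithin_le_nhds
    have h1 : Tendsto (fun s => ∑' μ, μ * ‖freePosition A w₀ v₀ s μ -
        freePosition A w₀ v₀ t μ‖ ^ 2) (𝓝 t) (𝓝 (∑' _ : ℝ, (0 : ℝ))) := by
      refine tendsto_tsum_of_dominated_convergence (hB.mul_left 8) (fun μ => ?_)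
        (Eventually.of_forall fun s μ => ?_)
      · have := ((((hcW μ).tendsto t).sub_const (freePosition A w₀ v₀ t μ)).norm.pow 2).const_mul μ
        simpa using this
      · have h0 := hA.mul_norm_sq_nonneg (w s - w t) μ
        rw [map_sub, hw, hw] at h0
        rw [Real.norm_of_nonneg h0]
        rcases le_or_gt μ 0 with hμ | hμ
        · simp [hA.freePosition_of_nonpos _ _ _ hμ, hA.spectralProj_eq_zero hμ]
        have := mul_le_mul_of_nonneg_left
          (norm_sub_sq_le_two (freePosition A w₀ v₀ s μ) (freePosition A w₀ v₀ t μ)) hμ.le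
        linarith [hA.mul_norm_freePosition_sq_le w₀ v₀ s μ,
          hA.mul_norm_freePosition_sq_le w₀ v₀ t μ]
    have h2 := ENNReal.tendsto_ofReal h1
    rw [tsum_zero, ENNReal.ofReal_zero] at h2
    refine h2.congr fun s => ?_
    have hm : MemH A 1 (w s - w t) := by
      rw [sub_eq_add_neg]
      exact hA.memH_add (hmem s) (memH_neg (hmem t))
    rw [← ENNReal.ofReal_toReal hm.ne, hA.toReal_normSq]
    congr 1
    exact tsum_congr fun μ => by rw [map_sub, hw, hw, zpow_one]
  · obtain ⟨hd, hd'⟩ := hA.mem_domain_of_spectralProj (hPw t)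
    refine ⟨hd, ?_⟩
    rw [hd']
    simp
  · exact hA.eq_of_spectralProj fun μ => by rw [hw]; simp [freePosition]
  · exact hA.eq_of_spectralProj fun μ => by rw [hv]; simp [freeVelocity]

end FreeEvolution

/-! ### Lifting a free solution by one level -/

section Antiderivative

/-- Since `μ ≤ 1 + μ²`, the graph norm controls the norm of `H₁`. This turns continuity of `v` in
`H` into continuity of `A⁻¹ v` in `H₁`. -/
theorem IsAdmissibleGenerator.normSq_one_le (hA : IsAdmissibleGenerator A) (u : A.domain) :
    normSq A 1 (u : H) ≤ ENNReal.ofReal (‖(u : H)‖ ^ 2 + ‖A u‖ ^ 2) := by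
  have hs := (hA.hasSum_norm_sq (u : H)).add (hA.hasSum_norm_sq (A u))
  have hle : ∀ μ : ℝ, μ ^ (1 : ℤ) * ‖spectralProj A μ u‖ ^ 2 ≤
      ‖spectralProj A μ u‖ ^ 2 + ‖spectralProj A μ (A u)‖ ^ 2 := fun μ => by
    rw [hA.spectralProj_apply, norm_smul, RCLike.norm_ofReal, mul_pow, sq_abs, zpow_one]
    nlinarith [mul_nonneg (sq_nonneg (μ - 1)) (sq_nonneg ‖spectralProj A μ u‖),
      mul_nonneg (sq_nonneg μ) (sq_nonneg ‖spectralProj A μ u‖), sq_nonneg ‖spectralProj A μ u‖]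
  rw [hA.normSq_eq, ← hs.tsum_eq, ENNReal.ofReal_tsum_of_nonneg (fun μ => by positivity)
    hs.summable]
  exact ENNReal.tsum_le_tsum fun μ => ENNReal.ofReal_le_ofReal (hle μ)

theorem IsAdmissibleGenerator.normSq_one_eq (hA : IsAdmissibleGenerator A) (u : A.domain) :
    normSq A 1 (u : H) = normSq A (-1) (A u) := by
  rw [hA.normSq_eq, hA.normSq_eq]
  refine tsum_congr fun μ => ?_
  congr 1
  rcases le_or_gt μ 0 with hμ | hμ
  · simp [hA.spectralProj_eq_zero hμ]
  rw [hA.spectralProj_apply, norm_smul, RCLike.norm_ofReal, mul_pow, sq_abs, zpow_one, zpow_neg,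
    zpow_one]
  field_simp

/-- Every free solution `(w, v)` is the time derivative of a free solution `(z, w)`, and the
energy of level `1` of `(z, w)` is the energy of level `0` of `(w, v)`. -/
theorem IsSolution.exists_antiderivative (hA : IsAdmissibleGenerator A) {T : ℝ} {w v : ℝ → H}
    (h : IsSolution A T (fun _ => 0) w v) :
    ∃ z : ℝ → H, IsSolution A T (fun _ => 0) z w ∧
      ∀ t, energy A 1 (z t) (w t) = energy A 0 (w t) (v t) := by
  obtain ⟨S, -, -, hS1, hS2⟩ := hA.exists_inverse
  have hnorm : ∀ x, normSq A 1 (S x) ≤ ENNReal.ofReal (‖S x‖ ^ 2 + ‖x‖ ^ 2) := fun x => by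
    obtain ⟨hd, hd'⟩ := hS1 x
    have := hA.normSq_one_le ⟨_, hd⟩
    rwa [hd'] at this
  have hzero : ∀ {t}, t ∈ Set.Icc 0 T → (0 : ℝ) ∈ Set.Icc 0 T := fun ht =>
    ⟨le_rfl, ht.1.trans ht.2⟩
  -- With `z = -A⁻¹ w'` one has formally `z' = -A⁻¹ w'' = w`. The two integrated equations of `(w,
  -- v)` exchange roles: applying `S` to the second gives the first one for `z`.
  refine ⟨fun t => -S (v t), ⟨fun t _ => memH_neg ((hnorm _).trans_lt ENNReal.ofReal_lt_top),
    fun t ht => ?_, h.continuousOn_w, fun t ht => ?_, fun t ht => ?_⟩, fun t => ?_⟩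
  · have hc : ContinuousOn (fun s => ENNReal.ofReal (‖S (v s - v t)‖ ^ 2 + ‖v s - v t‖ ^ 2))
        (Set.Icc 0 T) := by
      have := h.continuous_v
      exact ENNReal.continuous_ofReal.comp_continuousOn (by fun_prop)
    have h1 := (hc t ht).tendsto
    simp only [sub_self, map_zero, norm_zero, ne_eq, OfNat.ofNat_ne_zero, not_false_eq_true,
      zero_pow, add_zero, ENNReal.ofReal_zero] at h1
    refine tendsto_of_tendsto_of_tendsto_of_le_of_le tendsto_const_nhds h1
      (fun _ => zero_le) fun s => ?_
    have e : -S (v s) - -S (v t) = -S (v s - v t) := by rw [map_sub]; abel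
    simp only [e, normSq_neg]
    exact hnorm _
  · obtain ⟨hd, hv⟩ := h.eq_v t ht
    rw [intervalIntegral.integral_zero, add_zero] at hv
    rw [hv, map_sub, hS2]
    abel
  · have hi := h.intervalIntegrable_v (hzero ht) ht
    have e : ∫ s in (0 : ℝ)..t, -S (v s) = -S (∫ s in (0 : ℝ)..t, v s) := by
      rw [intervalIntegral.integral_neg, S.intervalIntegral_comp_comm hi]
    obtain ⟨hd, hd'⟩ := hS1 (∫ s in (0 : ℝ)..t, v s)
    have hm : ∫ s in (0 : ℝ)..t, -S (v s) ∈ A.domain := by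
      rw [e]; exact A.domain.neg_mem hd
    refine ⟨hm, ?_⟩
    have : (⟨_, hm⟩ : A.domain) = -⟨_, hd⟩ := Subtype.ext e
    rw [this, LinearPMap.map_neg, hd', intervalIntegral.integral_zero, add_zero, sub_neg_eq_add]
    exact h.eq_w t ht
  · obtain ⟨hd, hd'⟩ := hS1 (v t)
    have := hA.normSq_one_eq ⟨_, hd⟩
    rw [hd'] at this
    simp only [energy, normSq_neg, sub_self, zero_sub]
    rw [this, add_comm]

end Antiderivative

end

/-! ### From one window to arbitrarily long times -/

section

/-- A bound on all windows of length `τ` gives a bound on every longer interval. -/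
theorem integral_le_two_mul_of_window {g k : ℝ → ℝ} {τ T : ℝ} (hτ : 0 < τ) (hT : τ ≤ T)
    (hg : IntervalIntegrable g volume 0 T) (hk : IntervalIntegrable k volume 0 T)
    (hg0 : ∀ t, 0 ≤ g t) (hk0 : ∀ t, 0 ≤ k t)
    (h : ∀ t₀, 0 ≤ t₀ → τ + t₀ ≤ T → ∫ s in t₀..(τ + t₀), g s ≤ ∫ s in t₀..(τ + t₀), k s) :
    ∫ s in (0 : ℝ)..T, g s ≤ 2 * ∫ s in (0 : ℝ)..T, k s := by
  have hT0 : 0 ≤ T := hτ.le.trans hT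
  have sub : ∀ {φ : ℝ → ℝ}, IntervalIntegrable φ volume 0 T → ∀ {a b : ℝ}, 0 ≤ a → a ≤ T →
      0 ≤ b → b ≤ T → IntervalIntegrable φ volume a b := fun {φ} hφ {a b} h1 h2 h3 h4 =>
    hφ.mono_set (by rw [Set.uIcc_of_le hT0]; exact Set.uIcc_subset_Icc ⟨h1, h2⟩ ⟨h3, h4⟩)
  -- Disjoint windows fill `[0, nτ]`, and the window `[T - τ, T]` covers the rest. Each group costs
  -- at most the full integral of `k`, whence the factor `2`.
  set n := ⌊T / τ⌋₊
  have hn1 : n * τ ≤ T := by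
    have := Nat.floor_le (div_nonneg hT0 hτ.le)
    rwa [le_div_iff₀ hτ] at this
  have hn2 : T - τ ≤ n * τ := by
    have := Nat.lt_floor_add_one (T / τ)
    rw [div_lt_iff₀ hτ] at this
    linarith
  have hind : ∀ m : ℕ, m ≤ n → ∫ s in (0 : ℝ)..(m * τ), g s ≤ ∫ s in (0 : ℝ)..(m * τ), k s := by
    intro m
    induction m with
    | zero => simp
    | succ m ih =>
      intro hm
      have h1 : ((m + 1 : ℕ) : ℝ) * τ = τ + m * τ := by push_cast; ring
      have h2 : ((m + 1 : ℕ) : ℝ) * τ ≤ n * τ := by gcongr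
      have h3 : 0 ≤ m * τ := by positivity
      rw [h1] at h2 ⊢
      have h4 : τ + m * τ ≤ T := h2.trans hn1
      have h5 : m * τ ≤ T := by linarith
      rw [← intervalIntegral.integral_add_adjacent_intervals
        (sub hg le_rfl hT0 h3 h5) (sub hg h3 h5 (by linarith) h4),
        ← intervalIntegral.integral_add_adjacent_intervals
        (sub hk le_rfl hT0 h3 h5) (sub hk h3 h5 (by linarith) h4)]
      exact add_le_add (ih (by omega)) (h _ h3 h4)
  have hn0 : 0 ≤ n * τ := by positivity
  have e1 := intervalIntegral.integral_add_adjacent_intervals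
    (sub hg le_rfl hT0 hn0 hn1) (sub hg hn0 hn1 hT0 le_rfl)
  have e2 := intervalIntegral.integral_add_adjacent_intervals
    (sub hk le_rfl hT0 hn0 hn1) (sub hk hn0 hn1 hT0 le_rfl)
  have e3 := intervalIntegral.integral_add_adjacent_intervals
    (sub hk le_rfl hT0 (sub_nonneg.mpr hT) (by linarith))
    (sub hk (sub_nonneg.mpr hT) (by linarith) hT0 le_rfl)
  have e4 : ∫ s in (n * τ)..T, g s ≤ ∫ s in (T - τ)..T, g s :=
    intervalIntegral.integral_mono_interval hn2 hn1 le_rfl (Eventually.of_forall hg0)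
      (sub hg (sub_nonneg.mpr hT) (by linarith) hT0 le_rfl)
  have e5 := h (T - τ) (sub_nonneg.mpr hT) (by linarith)
  rw [add_sub_cancel] at e5
  have e6 : 0 ≤ ∫ s in (n * τ)..T, k s := intervalIntegral.integral_nonneg hn1 fun s _ => hk0 s
  have e7 : 0 ≤ ∫ s in (0 : ℝ)..(T - τ), k s :=
    intervalIntegral.integral_nonneg (sub_nonneg.mpr hT) fun s _ => hk0 s
  linarith [hind n le_rfl]

variable {𝕜 H G : Type*} [RCLike 𝕜] [NormedAddCommGroup H] [InnerProductSpace 𝕜 H]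
  [CompleteSpace H] [NormedSpace ℝ H] [IsScalarTower ℝ 𝕜 H]
  [NormedAddCommGroup G] [InnerProductSpace 𝕜 G] [CompleteSpace G]
  [NormedSpace ℝ G] [IsScalarTower ℝ 𝕜 G] {A : H →ₗ.[𝕜] H}

/-! ### Variation of the energy under a source -/

section EnergyVariation

variable {T : ℝ} {f w v : ℝ → H}

/-- The energy at two times differs by at most the work of the source term. -/
theorem IsSolution.energy_le_add (hA : IsAdmissibleGenerator A) (hf : MemL2 T f)
    (h : IsSolution A T f w v) {k : ℝ → ℝ} (hk : IntervalIntegrable k volume 0 T)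
    (hfk : ∀ s ∈ Set.Icc 0 T, ‖f s‖ * ‖v s‖ ≤ k s) {s t : ℝ} (hs : s ∈ Set.Icc 0 T)
    (ht : t ∈ Set.Icc 0 T) :
    energy A 1 (w t) (v t) ≤ energy A 1 (w s) (v s) + ∫ r in (0 : ℝ)..T, k r := by
  have hT : 0 ≤ T := hs.1.trans hs.2
  have h0T : (0 : ℝ) ∈ Set.Icc 0 T := ⟨le_rfl, hT⟩
  have hI : ∀ a ∈ Set.Icc 0 T, ∀ b ∈ Set.Icc 0 T,
      IntervalIntegrable (fun s => RCLike.re ⟪f s, v s⟫_𝕜) volume a b := fun a ha b hb =>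
    intervalIntegrable_re_inner (hf.intervalIntegrable ha hb)
      (h.continuous_v.mono (Set.uIcc_subset_Icc ha hb))
  have hsub : Set.uIoc s t ⊆ Set.uIoc 0 T := by
    rw [Set.uIoc_of_le hT]
    exact Set.Ioc_subset_Ioc (le_min hs.1 ht.1) (max_le hs.2 ht.2)
  have e1 : energy A 1 (w t) (v t) - energy A 1 (w s) (v s) =
      ∫ r in s..t, RCLike.re ⟪f r, v r⟫_𝕜 := by
    rw [h.energy_eq hA hf ht, h.energy_eq hA hf hs, add_sub_add_left_eq_sub,
      intervalIntegral.integral_interval_sub_left (hI 0 h0T t ht) (hI 0 h0T s hs)]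
  have hk0 : ∀ r ∈ Set.uIoc 0 T, 0 ≤ k r := fun r hr => by
    rw [Set.uIoc_of_le hT] at hr
    exact (by positivity : 0 ≤ ‖f r‖ * ‖v r‖).trans (hfk r (Set.Ioc_subset_Icc_self hr))
  have e2 : ‖∫ r in s..t, RCLike.re ⟪f r, v r⟫_𝕜‖ ≤ |∫ r in s..t, k r| := by
    refine intervalIntegral.norm_integral_le_abs_of_norm_le ?_
      (hk.mono_set (by rw [Set.uIcc_of_le hT]; exact Set.uIcc_subset_Icc hs ht))
    refine (ae_restrict_iff' measurableSet_uIoc).mpr (Eventually.of_forall fun r hr => ?_)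
    have hr' := hsub hr
    rw [Set.uIoc_of_le hT] at hr'
    exact (RCLike.norm_re_le_norm _).trans ((norm_inner_le_norm _ _).trans
      (hfk r (Set.Ioc_subset_Icc_self hr')))
  have e3 : |∫ r in s..t, k r| ≤ |∫ r in (0 : ℝ)..T, k r| :=
    intervalIntegral.abs_integral_mono_interval hsub
      ((ae_restrict_iff' measurableSet_uIoc).mpr (Eventually.of_forall hk0)) hk
  have e4 : |∫ r in (0 : ℝ)..T, k r| = ∫ r in (0 : ℝ)..T, k r := by
    rw [abs_of_nonneg]
    exact intervalIntegral.integral_nonneg hT fun r hr =>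
      (by positivity : 0 ≤ ‖f r‖ * ‖v r‖).trans (hfk r hr)
  have e5 := le_abs_self (∫ r in s..t, RCLike.re ⟪f r, v r⟫_𝕜)
  rw [← Real.norm_eq_abs] at e5
  linarith

/-- Averaged form of `IsSolution.energy_le_add`. -/
theorem IsSolution.mul_energy_le (hA : IsAdmissibleGenerator A) (hf : MemL2 T f)
    (h : IsSolution A T f w v) {k : ℝ → ℝ} (hk : IntervalIntegrable k volume 0 T)
    (hfk : ∀ s ∈ Set.Icc 0 T, ‖f s‖ * ‖v s‖ ≤ k s) {t : ℝ} (ht : t ∈ Set.Icc 0 T) :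
    T * energy A 1 (w t) (v t) ≤
      (∫ s in (0 : ℝ)..T, energy A 1 (w s) (v s)) + T * ∫ r in (0 : ℝ)..T, k r := by
  have hT : 0 ≤ T := ht.1.trans ht.2
  have hi := h.intervalIntegrable_energy hA hf (a := 0) (b := T) ⟨le_rfl, hT⟩ ⟨hT, le_rfl⟩
  have := intervalIntegral.integral_mono_on hT
    (intervalIntegrable_const (c := energy A 1 (w t) (v t)))
    (hi.add intervalIntegrable_const) fun s hs => h.energy_le_add hA hf hk hfk hs ht
  rw [intervalIntegral.integral_add hi intervalIntegrable_const] at this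
  simpa using this

/-- The energy of a solution with zero initial data is controlled by the source. -/
theorem IsSolution.energy_le_of_zero_data (hA : IsAdmissibleGenerator A) (hT : 0 < T)
    (hf : MemL2 T f) (h : IsSolution A T f w v) (h0 : energy A 1 (w 0) (v 0) = 0) :
    energy A 1 (w T) (v T) ≤ 2 * T * (∫ s in (0 : ℝ)..T, ‖f s‖ ^ 2) ∧
      ∫ s in (0 : ℝ)..T, energy A 1 (w s) (v s) ≤
        2 * T ^ 2 * ∫ s in (0 : ℝ)..T, ‖f s‖ ^ 2 := by
  have h0T : (0 : ℝ) ∈ Set.Icc 0 T := ⟨le_rfl, hT.le⟩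
  have hTT : T ∈ Set.Icc 0 T := ⟨hT.le, le_rfl⟩
  have hi := h.intervalIntegrable_energy hA hf h0T hTT
  have hf2 := hf.intervalIntegrable_norm_sq h0T hTT
  set F := ∫ s in (0 : ℝ)..T, ‖f s‖ ^ 2
  set I := ∫ s in (0 : ℝ)..T, energy A 1 (w s) (v s)
  -- The weights are chosen so that integrating the resulting bound over `[0,T]` reproduces `I / 2`,
  -- which is absorbed.
  have hk : ∀ s ∈ Set.Icc 0 T, ‖f s‖ * ‖v s‖ ≤
      T * ‖f s‖ ^ 2 + (2 * T)⁻¹ * energy A 1 (w s) (v s) := fun s _ => by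
    have h1 := hA.norm_sq_le_energy (w s) (v s)
    have h2 : T * ‖f s‖ ^ 2 + (4 * T)⁻¹ * ‖v s‖ ^ 2 - ‖f s‖ * ‖v s‖ =
        (4 * T)⁻¹ * (2 * T * ‖f s‖ - ‖v s‖) ^ 2 := by
      field_simp
      ring
    have h3 : 0 ≤ (4 * T)⁻¹ * (2 * T * ‖f s‖ - ‖v s‖) ^ 2 := by positivity
    have h4 : (4 * T)⁻¹ * ‖v s‖ ^ 2 ≤ (4 * T)⁻¹ * (2 * energy A 1 (w s) (v s)) := by gcongr
    have h5 : (4 * T)⁻¹ * (2 * energy A 1 (w s) (v s)) =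
        (2 * T)⁻¹ * energy A 1 (w s) (v s) := by
      field_simp
      ring
    linarith
  have hkint : ∫ s in (0 : ℝ)..T, (T * ‖f s‖ ^ 2 + (2 * T)⁻¹ * energy A 1 (w s) (v s)) =
      T * F + (2 * T)⁻¹ * I := by
    rw [intervalIntegral.integral_add (hf2.const_mul _) (hi.const_mul _),
      intervalIntegral.integral_const_mul, intervalIntegral.integral_const_mul]
  have hle : ∀ t ∈ Set.Icc 0 T, energy A 1 (w t) (v t) ≤ T * F + (2 * T)⁻¹ * I :=
    fun t ht => by
      have := h.energy_le_add hA hf ((hf2.const_mul _).add (hi.const_mul _)) hk h0T ht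
      rw [h0, hkint] at this
      linarith
  have hI := intervalIntegral.integral_mono_on hT.le hi intervalIntegrable_const hle
  rw [intervalIntegral.integral_const, smul_eq_mul, sub_zero] at hI
  have hI' : I ≤ 2 * T ^ 2 * F := by
    have e : T * (T * F + (2 * T)⁻¹ * I) = T ^ 2 * F + I / 2 := by field_simp
    rw [e] at hI
    change I ≤ _ at hI
    linarith
  refine ⟨(hle T hTT).trans ?_, hI'⟩
  have h6 : (2 * T)⁻¹ * I ≤ (2 * T)⁻¹ * (2 * T ^ 2 * F) := by gcongr
  have h7 : (2 * T)⁻¹ * (2 * T ^ 2 * F) = T * F := by field_simp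
  linarith

end EnergyVariation

/-! ### Uniform observability constants -/

section Observation

variable {Bs : (A.domain × H) →ₗ[𝕜] G} {T : ℝ}

theorem IsObservation.sub {w₁ v₁ w₂ v₂ : ℝ → H} {y₁ y₂ : ℝ → G}
    (h₁ : IsObservation A Bs T w₁ v₁ y₁) (h₂ : IsObservation A Bs T w₂ v₂ y₂)
    (hw₁ : ContinuousOn w₁ (Set.Icc 0 T)) (hw₂ : ContinuousOn w₂ (Set.Icc 0 T))
    (hv₁ : ContinuousOn v₁ (Set.Icc 0 T)) (hv₂ : ContinuousOn v₂ (Set.Icc 0 T)) :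
    IsObservation A Bs T (fun t => w₁ t - w₂ t) (fun t => v₁ t - v₂ t)
      (fun t => y₁ t - y₂ t) := by
  refine ⟨MemLp.sub h₁.1 h₂.1, fun t ht => ?_⟩
  have h0T : (0 : ℝ) ∈ Set.Icc 0 T := ⟨le_rfl, ht.1.trans ht.2⟩
  obtain ⟨hd₁, e₁⟩ := h₁.2 t ht
  obtain ⟨hd₂, e₂⟩ := h₂.2 t ht
  have ew := intervalIntegral.integral_sub (hw₁.memL2.intervalIntegrable h0T ht)
    (hw₂.memL2.intervalIntegrable h0T ht)
  have ev := intervalIntegral.integral_sub (hv₁.memL2.intervalIntegrable h0T ht)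
    (hv₂.memL2.intervalIntegrable h0T ht)
  have hd : ∫ s in (0 : ℝ)..t, (w₁ s - w₂ s) ∈ A.domain := by
    rw [ew]; exact A.domain.sub_mem hd₁ hd₂
  refine ⟨hd, ?_⟩
  rw [intervalIntegral.integral_sub (h₁.1.intervalIntegrable h0T ht)
    (h₂.1.intervalIntegrable h0T ht), e₁, e₂, ← map_sub]
  congr 1
  exact Prod.ext (Subtype.ext ew.symm) ev.symm

theorem IsObservation.shift {w v : ℝ → H} {y : ℝ → G} (h : IsObservation A Bs T w v y)
    (hw : ContinuousOn w (Set.Icc 0 T)) (hv : ContinuousOn v (Set.Icc 0 T)) {t₀ τ : ℝ}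
    (h0 : 0 ≤ t₀) (hτ : τ + t₀ ≤ T) :
    IsObservation A Bs τ (fun s => w (s + t₀)) (fun s => v (s + t₀)) (fun s => y (s + t₀)) := by
  refine ⟨h.1.comp_add_right h0 hτ, fun t ht => ?_⟩
  have h1 : t + t₀ ∈ Set.Icc 0 T := ⟨add_nonneg ht.1 h0, by linarith [ht.2]⟩
  have h0T : (0 : ℝ) ∈ Set.Icc 0 T := ⟨le_rfl, h1.1.trans h1.2⟩
  have h2 : t₀ ∈ Set.Icc 0 T := ⟨h0, by linarith [ht.1, ht.2]⟩
  obtain ⟨hd₁, e₁⟩ := h.2 _ h1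
  obtain ⟨hd₂, e₂⟩ := h.2 _ h2
  have ew := integral_comp_add_right_eq_sub (hw.memL2.intervalIntegrable h0T h1)
    (hw.memL2.intervalIntegrable h0T h2)
  have ev := integral_comp_add_right_eq_sub (hv.memL2.intervalIntegrable h0T h1)
    (hv.memL2.intervalIntegrable h0T h2)
  have hd : ∫ s in (0 : ℝ)..t, w (s + t₀) ∈ A.domain := by
    rw [ew]; exact A.domain.sub_mem hd₁ hd₂
  refine ⟨hd, ?_⟩
  rw [integral_comp_add_right_eq_sub (h.1.intervalIntegrable h0T h1)
    (h.1.intervalIntegrable h0T h2), e₁, e₂, ← map_sub]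
  congr 1
  exact Prod.ext (Subtype.ext ew.symm) ev.symm

/-- Observability of the free equation in time `τ` extends to the equation with a source. -/
theorem exists_observability_with_source (hA : IsAdmissibleGenerator A) (hB : IsAdmissible A Bs)
    {τ c : ℝ} (hτ : 0 < τ) (hc : 0 < c)
    (hobs : ∀ w v : ℝ → H, IsSolution A τ (fun _ => 0) w v → ∀ y : ℝ → G,
      IsObservation A Bs τ w v y → c * energy A 1 (w 0) (v 0) ≤ ∫ t in (0 : ℝ)..τ, ‖y t‖ ^ 2) :
    ∃ η > 0, ∃ α > 0, ∀ (f w v : ℝ → H) (y : ℝ → G), MemL2 τ f → IsSolution A τ f w v →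
      IsObservation A Bs τ w v y → ∫ t in (0 : ℝ)..τ, energy A 1 (w t) (v t) ≤
        η * (∫ t in (0 : ℝ)..τ, ‖y t‖ ^ 2) + α * ∫ t in (0 : ℝ)..τ, ‖f t‖ ^ 2 := by
  obtain ⟨b, hb, hadm⟩ := hB.2 τ hτ
  refine ⟨4 * τ / c, by positivity,
    4 * τ / c * (b * (2 * τ + 2 * τ ^ 2 + 1)) + 4 * τ ^ 2, by positivity, ?_⟩
  intro f w v y hf h hy
  have h0T : (0 : ℝ) ∈ Set.Icc 0 τ := ⟨le_rfl, hτ.le⟩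
  have hTT : τ ∈ Set.Icc 0 τ := ⟨hτ.le, le_rfl⟩
  have hz : MemL2 τ (fun _ => (0 : H)) := continuousOn_const.memL2
  obtain ⟨w', v', h', hw0, hv0⟩ := hA.exists_free_solution τ (h.mem_H1 0 h0T) (v 0)
  -- Subtracting the free solution with the same data leaves a solution with zero data, driven by
  -- `f` alone.
  have hψ : IsSolution A τ f (fun t => w t + -w' t) (fun t => v t + -v' t) := by
    have hz' : MemL2 τ (fun _ => (-0 : H)) := continuousOn_const.memL2
    have := IsSolution.add hA hf hz' h h'.neg
    simpa only [neg_zero, add_zero] using this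
  have hψ0 : energy A 1 (w 0 + -w' 0) (v 0 + -v' 0) = 0 := by
    simp [hw0, hv0, energy, normSq]
  obtain ⟨b1, b2⟩ := hψ.energy_le_of_zero_data hA hτ hf hψ0
  obtain ⟨z, hz1, hz2⟩ := hadm f _ _ hf hψ
  rw [hψ0] at hz2
  set F := ∫ t in (0 : ℝ)..τ, ‖f t‖ ^ 2
  set Y := ∫ t in (0 : ℝ)..τ, ‖y t‖ ^ 2
  set Z := ∫ t in (0 : ℝ)..τ, ‖z t‖ ^ 2
  -- The three summands bound the final energy, the integrated energy and the source term in the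
  -- admissibility estimate; the initial energy is zero.
  have hZ : Z ≤ b * (2 * τ + 2 * τ ^ 2 + 1) * F := by
    refine hz2.trans ?_
    rw [mul_assoc]
    gcongr
    linarith
  have hfree : IsObservation A Bs τ w' v' (fun t => y t - z t) := by
    have := hy.sub hz1 h.continuousOn_w hψ.continuousOn_w h.continuous_v hψ.continuous_v
    simpa using this
  have hE := hobs w' v' h' _ hfree
  have hyz : ∫ t in (0 : ℝ)..τ, ‖y t - z t‖ ^ 2 ≤ 2 * (Y + Z) := by
    have hy2 := hy.1.intervalIntegrable_norm_sq h0T hTT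
    have hz2' := hz1.1.intervalIntegrable_norm_sq h0T hTT
    rw [← intervalIntegral.integral_add hy2 hz2', ← intervalIntegral.integral_const_mul]
    exact intervalIntegral.integral_mono_on hτ.le (hfree.1.intervalIntegrable_norm_sq h0T hTT)
      ((hy2.add hz2').const_mul _) fun t _ => norm_sub_sq_le_two _ _
  have hi := h.intervalIntegrable_energy hA hf h0T hTT
  have hi' := h'.intervalIntegrable_energy hA hz h0T hTT
  have hiψ := hψ.intervalIntegrable_energy hA hf h0T hTT
  have hsum : ∫ t in (0 : ℝ)..τ, energy A 1 (w t) (v t) ≤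
      2 * (∫ t in (0 : ℝ)..τ, energy A 1 (w' t) (v' t)) +
      2 * ∫ t in (0 : ℝ)..τ, energy A 1 (w t + -w' t) (v t + -v' t) := by
    rw [← intervalIntegral.integral_const_mul, ← intervalIntegral.integral_const_mul,
      ← intervalIntegral.integral_add (hi'.const_mul _) (hiψ.const_mul _)]
    refine intervalIntegral.integral_mono_on hτ.le hi ((hi'.const_mul _).add (hiψ.const_mul _))
      fun t ht => ?_
    have := hA.energy_add_le one_pos (h'.mem_H1 t ht) (hψ.mem_H1 t ht) (v' t) (v t + -v' t)
    rw [add_comm (w' t), add_comm (v' t), neg_add_cancel_right, neg_add_cancel_right] at this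
    linarith
  have hconst : ∫ t in (0 : ℝ)..τ, energy A 1 (w' t) (v' t) = τ * energy A 1 (w' 0) (v' 0) := by
    have : ∫ t in (0 : ℝ)..τ, energy A 1 (w' t) (v' t) =
        ∫ t in (0 : ℝ)..τ, energy A 1 (w' 0) (v' 0) := by
      refine intervalIntegral.integral_congr fun t ht => ?_
      rw [Set.uIcc_of_le hτ.le] at ht
      exact h'.energy_const hA ht
    rw [this]
    simp
  rw [hconst] at hsum
  have hE' : energy A 1 (w' 0) (v' 0) ≤ 2 / c * (Y + b * (2 * τ + 2 * τ ^ 2 + 1) * F) := by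
    rw [div_mul_eq_mul_div, le_div_iff₀ hc]
    linarith
  have hfin := mul_le_mul_of_nonneg_left hE' (show 0 ≤ 2 * τ by positivity)
  have e : 2 * τ * (2 / c * (Y + b * (2 * τ + 2 * τ ^ 2 + 1) * F)) =
      4 * τ / c * Y + 4 * τ / c * (b * (2 * τ + 2 * τ ^ 2 + 1)) * F := by
    field_simp
    ring
  linarith

theorem exists_uniformlyObserves (hA : IsAdmissibleGenerator A) (hB : IsAdmissible A Bs)
    {T₀ : ℝ} (hT₀ : 0 < T₀) (hobs : Observes A Bs T₀) {τ : ℝ} (hτ : T₀ < τ) :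
    ∃ η₀ > 0, ∃ α₀ > 0, UniformlyObserves A Bs τ η₀ α₀ := by
  have hτ0 : 0 < τ := hT₀.trans hτ
  obtain ⟨c, hc, hobs⟩ := hobs τ hτ
  obtain ⟨η, hη, α, hα, hloc⟩ := exists_observability_with_source hA hB hτ0 hc hobs
  refine ⟨2 * η, by positivity, 2 * α, by positivity, fun T hT f w v hf h y hy => ?_⟩
  have hT0 : 0 < T := hτ0.trans hT
  have h0T : (0 : ℝ) ∈ Set.Icc 0 T := ⟨le_rfl, hT0.le⟩
  have hTT : T ∈ Set.Icc 0 T := ⟨hT0.le, le_rfl⟩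
  have hf2 : ∀ {a b}, a ∈ Set.Icc 0 T → b ∈ Set.Icc 0 T →
    IntervalIntegrable (fun t => α * ‖f t‖ ^ 2) volume a b :=
    fun ha hb => (hf.intervalIntegrable_norm_sq ha hb).const_mul α
  have hy2 : ∀ {a b}, a ∈ Set.Icc 0 T → b ∈ Set.Icc 0 T →
    IntervalIntegrable (fun t => η * ‖y t‖ ^ 2) volume a b :=
    fun ha hb => (hy.1.intervalIntegrable_norm_sq ha hb).const_mul η
  have key := integral_le_two_mul_of_window hτ0 hT.le
    (h.intervalIntegrable_energy hA hf h0T hTT) ((hy2 h0T hTT).add (hf2 h0T hTT))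
    (fun t => energy_nonneg _ _ _) (fun t => by positivity) ?_
  · rw [intervalIntegral.integral_add (hy2 h0T hTT) (hf2 h0T hTT),
      intervalIntegral.integral_const_mul, intervalIntegral.integral_const_mul] at key
    linarith
  · intro t₀ h0 h1
    have m0 : t₀ ∈ Set.Icc 0 T := ⟨h0, by linarith⟩
    have m1 : τ + t₀ ∈ Set.Icc 0 T := ⟨by linarith, h1⟩
    rw [intervalIntegral.integral_add (hy2 m0 m1) (hf2 m0 m1),
      intervalIntegral.integral_const_mul, intervalIntegral.integral_const_mul]
    have := hloc _ _ _ _ (hf.comp_add_right h0 h1) (h.shift hf h0 h1)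
      (hy.shift h.continuousOn_w h.continuous_v h0 h1)
    rw [intervalIntegral.integral_comp_add_right (fun t => energy A 1 (w t) (v t)),
      intervalIntegral.integral_comp_add_right (fun t => ‖y t‖ ^ 2),
      intervalIntegral.integral_comp_add_right (fun t => ‖f t‖ ^ 2)] at this
    simpa only [zero_add] using this

/-- Free energy is conserved, so observability on each window bounds the same number `e₁(V)(0)`.
Adding the windows produces the factor `T`. -/
theorem exists_uniformlyObservesVelocity (hA : IsAdmissibleGenerator A) {Pi : H →L[𝕜] H}
    {T₀ : ℝ} (hT₀ : 0 < T₀) (hobs : ObservesVelocity A Pi T₀) {τ : ℝ} (hτ : T₀ < τ) :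
    ∃ γ₀ > 0, UniformlyObservesVelocity A Pi τ γ₀ := by
  have hτ0 : 0 < τ := hT₀.trans hτ
  obtain ⟨c, hc, hobs⟩ := hobs τ hτ
  refine ⟨2 * (τ / c), by positivity, fun T hT w v h => ?_⟩
  have hT0 : 0 < T := hτ0.trans hT
  have h0T : (0 : ℝ) ∈ Set.Icc 0 T := ⟨le_rfl, hT0.le⟩
  have hTT : T ∈ Set.Icc 0 T := ⟨hT0.le, le_rfl⟩
  have hPv : ContinuousOn (fun t => ‖Pi (v t)‖ ^ 2) (Set.Icc 0 T) := by
    have := h.continuous_v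
    fun_prop
  have key := integral_le_two_mul_of_window (g := fun _ => energy A 1 (w 0) (v 0))
    (k := fun t => τ / c * ‖Pi (v t)‖ ^ 2) hτ0 hT.le intervalIntegrable_const
    ((hPv.mono (Set.uIcc_subset_Icc h0T hTT)).intervalIntegrable.const_mul _)
    (fun t => energy_nonneg _ _ _) (fun t => by positivity) ?_
  · rw [intervalIntegral.integral_const_mul, intervalIntegral.integral_const, smul_eq_mul,
      sub_zero] at key
    linarith
  · intro t₀ h0 h1
    have := hobs _ _ (h.shift continuousOn_const.memL2 h0 h1)
    rw [intervalIntegral.integral_comp_add_right (fun t => ‖Pi (v t)‖ ^ 2)] at this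
    simp only [zero_add] at this
    rw [h.energy_const hA ⟨h0, by linarith⟩] at this
    rw [intervalIntegral.integral_const_mul, intervalIntegral.integral_const, smul_eq_mul,
      add_sub_cancel_right, div_mul_eq_mul_div, le_div_iff₀ hc]
    have h3 := mul_le_mul_of_nonneg_left this hτ0.le
    linarith

end Observation

end

section

/-! ### The explicit constants -/

section ConstantBounds

variable {α β γ₀ : ℝ}

/-- With `s² = a² + a + b`, the denominator of `M` is `(2a + 1)s + 2s²`. In the form `1/M = 2a + 1 +
2s` the constant can be compared with the estimates. -/
theorem inv_constM (hα : 0 < α) (hβ : 0 < β) (hγ : 0 < γ₀) :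
    (constM α β γ₀)⁻¹ = 2 * constA α β γ₀ + 1 +
      2 * √(constA α β γ₀ ^ 2 + constA α β γ₀ + constB α β γ₀) := by
  have ha : 0 < constA α β γ₀ := by unfold constA c₃; positivity
  have hb : 0 < constB α β γ₀ := by unfold constB c₄; positivity
  unfold constM
  simp only
  set a := constA α β γ₀
  set b := constB α β γ₀
  have hpos : 0 < a ^ 2 + a + b := by positivity
  have hs : 0 < √(a ^ 2 + a + b) := Real.sqrt_pos.mpr hpos
  have hsq := Real.sq_sqrt hpos.le
  set s := √(a ^ 2 + a + b)
  rw [inv_div, div_eq_iff hs.ne']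
  linear_combination (-2) * hsq

theorem constM_pos (hα : 0 < α) (hβ : 0 < β) (hγ : 0 < γ₀) : 0 < constM α β γ₀ := by
  rw [← inv_pos, inv_constM hα hβ hγ]
  have ha : 0 < constA α β γ₀ := by unfold constA c₃; positivity
  positivity

theorem constκ_pos (hα : 0 < α) (hβ : 0 < β) (hγ : 0 < γ₀) : 0 < constκ α β γ₀ := by
  have := constM_pos hα hβ hγ
  unfold constκ c₃ c₄
  positivity

theorem constK_pos (hα : 0 < α) (hβ : 0 < β) (hγ : 0 < γ₀) {η₀ : ℝ} (hη : 0 < η₀) :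
    0 < constK α β γ₀ η₀ := by
  have := constM_pos hα hβ hγ
  have := constκ_pos hα hβ hγ
  unfold constK
  positivity

/-- This sum is `2T²` times the coefficient of `I` in the final absorption; it explains the
definitions of `T₁` and `T₂`. -/
theorem time_sq_add (hα : 0 < α) (hβ : 0 < β) (hγ : 0 < γ₀) {α₀ : ℝ} (hα₀ : 0 < α₀) :
    time₁ α β γ₀ α₀ ^ 2 + time₂ α β γ₀ α₀ ^ 2 =
      2 * (α₀ * β * (γ₀ / α) * constκ α β γ₀) := by
  have hM := constM_pos hα hβ hγ
  unfold time₁ time₂ constκ c₃ c₄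
  rw [div_pow, div_pow, mul_pow, mul_pow, Real.sq_sqrt (by positivity),
    Real.sq_sqrt (by positivity), Real.sq_sqrt (by positivity)]
  field_simp
  ring

theorem time₁_nonneg (hα : 0 < α) (hβ : 0 < β) (hγ : 0 < γ₀) {α₀ : ℝ} :
    0 ≤ time₁ α β γ₀ α₀ := by
  unfold time₁
  positivity

theorem time₂_nonneg {α₀ : ℝ} : 0 ≤ time₂ α β γ₀ α₀ := by
  unfold time₂
  positivity

/-- This and the next two identities factor each constant the way its estimate is obtained:
`e₀(U₁)(0)` from `X`, then `X` and `E₀` from `I`. The large-time bounds thereby reduce to the one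
for `k₂`. -/
theorem d₁_eq {α₀ η₀ T : ℝ} :
    d₁ α β γ₀ α₀ η₀ T = γ₀ / α / T * r₂ α β γ₀ α₀ η₀ T := by
  unfold d₁ r₂
  simp only [div_eq_mul_inv, mul_inv]
  ring

theorem r₂_eq {α₀ η₀ T : ℝ} (hT : T ≠ 0) :
    r₂ α β γ₀ α₀ η₀ T = γ₀ / α * constκ α β γ₀ / T ^ 2 * k₂ α β γ₀ α₀ η₀ T := by
  unfold r₂ k₂
  rw [show 2 * η₀ * T ^ 2 / (T ^ 2 - time₂ α β γ₀ α₀ ^ 2) =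
    T ^ 2 * (2 * η₀ / (T ^ 2 - time₂ α β γ₀ α₀ ^ 2)) by ring, ← mul_assoc,
    div_mul_cancel₀ _ (pow_ne_zero 2 hT)]
  simp only [div_eq_mul_inv, mul_inv]
  ring

theorem d₂_eq {α₀ η₀ T : ℝ} (hT : T ≠ 0) :
    d₂ α β γ₀ α₀ η₀ T = (constM α β γ₀)⁻¹ / T * k₂ α β γ₀ α₀ η₀ T := by
  unfold d₂ k₂
  rw [show 2 * η₀ * T ^ 2 / (T ^ 2 - time₂ α β γ₀ α₀ ^ 2) =
    T * (2 * η₀ * T / (T ^ 2 - time₂ α β γ₀ α₀ ^ 2)) by ring, ← mul_assoc,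
    div_mul_cancel₀ _ hT]
  simp only [div_eq_mul_inv, mul_inv]
  ring

/-- The bounds of the constants for large times. -/
theorem constants_le (hα : 0 < α) (hβ : 0 < β) (hγ : 0 < γ₀) {α₀ η₀ T : ℝ} (hη : 0 < η₀)
    (hT : 0 < T) (h : √2 * time₂ α β γ₀ α₀ ≤ T) :
    d₁ α β γ₀ α₀ η₀ T ≤ constK α β γ₀ η₀ / T ^ 3 ∧ d₂ α β γ₀ α₀ η₀ T ≤ constK α β γ₀ η₀ / T ∧
      k₂ α β γ₀ α₀ η₀ T ≤ constK α β γ₀ η₀ ∧ r₂ α β γ₀ α₀ η₀ T ≤ constK α β γ₀ η₀ / T ^ 2 := by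
  have hM := constM_pos hα hβ hγ
  have hκ := constκ_pos hα hβ hγ
  have h2 : T ^ 2 / 2 ≤ T ^ 2 - time₂ α β γ₀ α₀ ^ 2 := by
    have h3 : (√2 * time₂ α β γ₀ α₀) ^ 2 ≤ T ^ 2 :=
      pow_le_pow_left₀ (mul_nonneg (Real.sqrt_nonneg _) time₂_nonneg) h 2
    rw [mul_pow, Real.sq_sqrt (by norm_num)] at h3
    linarith
  have hk : k₂ α β γ₀ α₀ η₀ T ≤ 4 * η₀ := by
    unfold k₂
    rw [div_le_iff₀ (lt_of_lt_of_le (by positivity) h2)]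
    nlinarith
  have hK1 : 4 * η₀ ≤ constK α β γ₀ η₀ := by
    unfold constK
    refine le_mul_of_one_le_right (by positivity) ?_
    have : 0 ≤ 1 / constM α β γ₀ + (γ₀ / α + γ₀ ^ 2 / α ^ 2) * constκ α β γ₀ := by positivity
    linarith
  have hK2 : (constM α β γ₀)⁻¹ * (4 * η₀) ≤ constK α β γ₀ η₀ := by
    unfold constK
    rw [mul_comm]
    refine mul_le_mul_of_nonneg_left ?_ (by positivity)
    rw [one_div]
    have : 0 ≤ (γ₀ / α + γ₀ ^ 2 / α ^ 2) * constκ α β γ₀ := by positivity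
    linarith
  have hK3 : γ₀ / α * constκ α β γ₀ * (4 * η₀) ≤ constK α β γ₀ η₀ := by
    unfold constK
    rw [mul_comm]
    refine mul_le_mul_of_nonneg_left ?_ (by positivity)
    have h4 : 0 ≤ 1 / constM α β γ₀ := by positivity
    have h5 : 0 ≤ γ₀ ^ 2 / α ^ 2 * constκ α β γ₀ := by positivity
    linarith
  have hK4 : γ₀ ^ 2 / α ^ 2 * constκ α β γ₀ * (4 * η₀) ≤ constK α β γ₀ η₀ := by
    unfold constK
    rw [mul_comm]
    refine mul_le_mul_of_nonneg_left ?_ (by positivity)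
    have h4 : 0 ≤ 1 / constM α β γ₀ := by positivity
    have h5 : 0 ≤ γ₀ / α * constκ α β γ₀ := by positivity
    linarith
  have hr : r₂ α β γ₀ α₀ η₀ T ≤ γ₀ / α * constκ α β γ₀ * (4 * η₀) / T ^ 2 := by
    rw [r₂_eq hT.ne', div_mul_eq_mul_div]
    gcongr
  refine ⟨?_, ?_, hk.trans hK1, ?_⟩
  · rw [d₁_eq]
    calc γ₀ / α / T * r₂ α β γ₀ α₀ η₀ T
        ≤ γ₀ / α / T * (γ₀ / α * constκ α β γ₀ * (4 * η₀) / T ^ 2) := by gcongr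
      _ = γ₀ ^ 2 / α ^ 2 * constκ α β γ₀ * (4 * η₀) / T ^ 3 := by field_simp
      _ ≤ constK α β γ₀ η₀ / T ^ 3 := by gcongr
  · rw [d₂_eq hT.ne']
    calc (constM α β γ₀)⁻¹ / T * k₂ α β γ₀ α₀ η₀ T
        ≤ (constM α β γ₀)⁻¹ / T * (4 * η₀) := by gcongr
      _ = (constM α β γ₀)⁻¹ * (4 * η₀) / T := by ring
      _ ≤ constK α β γ₀ η₀ / T := by gcongr
  · exact hr.trans (by gcongr)

/-- The algebra behind the cascade estimates: `X` is the coupling term, `E₀, E₁` are the initial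
and final energies of the observed component and `I` is its time integral. -/
theorem coupling_bounds (hα : 0 < α) (hβ : 0 < β) (hγ : 0 < γ₀) {T X E₀ E₁ I : ℝ} (hT : 0 < T)
    (hI : 0 ≤ I) (hX : X ≤ 8 * (γ₀ / α) / T * (E₀ + E₁))
    (h₀ : ∀ δ > 0, T * E₀ ≤ I + T * (δ * β / 2 * X + δ⁻¹ * I))
    (h₁ : ∀ δ > 0, T * E₁ ≤ I + T * (δ * β / 2 * X + δ⁻¹ * I)) :
    X ≤ γ₀ / α * constκ α β γ₀ / T ^ 2 * I ∧ E₀ ≤ (constM α β γ₀)⁻¹ / T * I := by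
  have hq : 0 < γ₀ / α := by positivity
  have haq : constA α β γ₀ = 16 * β * (γ₀ / α) := by
    unfold constA c₃
    field_simp
    ring
  have hb : 0 < constB α β γ₀ := by unfold constB c₄; positivity
  have hκ : constκ α β γ₀ = 32 * (constM α β γ₀)⁻¹ + 128 * β * (γ₀ / α) := by
    unfold constκ c₃ c₄
    ring
  rw [inv_constM hα hβ hγ] at hκ ⊢
  set q := γ₀ / α
  have ha : 0 < constA α β γ₀ := by rw [haq]; positivity
  set a := constA α β γ₀
  set b := constB α β γ₀
  have hpos : 0 < a ^ 2 + a + b := by positivity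
  have hs : 0 < √(a ^ 2 + a + b) := Real.sqrt_pos.mpr hpos
  have hsq := Real.sq_sqrt hpos.le
  set s := √(a ^ 2 + a + b)
  have hX1 : X * T ^ 2 ≤ (32 * q + 512 * q ^ 2 * β) * I := by
    -- With this `δ` the coupling term returns in the bound for `X T²` with coefficient exactly
    -- `1/2` and can be absorbed.
    have d0 : 0 < T / (16 * q * β) := by positivity
    have e0 := h₀ _ d0
    have e1 := h₁ _ d0
    have e2 : T * (T / (16 * q * β) * β / 2 * X + (T / (16 * q * β))⁻¹ * I) =
        T ^ 2 * X / (32 * q) + 16 * q * β * I := by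
      field_simp
      ring
    rw [e2] at e0 e1
    have e3 : X * T ^ 2 ≤ 8 * q * (T * E₀ + T * E₁) := by
      have := mul_le_mul_of_nonneg_right hX (sq_nonneg T)
      refine this.trans (le_of_eq ?_)
      field_simp
    have e4 : 8 * q * (T * E₀ + T * E₁) ≤
        8 * q * (2 * (I + (T ^ 2 * X / (32 * q) + 16 * q * β * I))) := by
      gcongr
      linarith
    have e5 : 8 * q * (2 * (I + (T ^ 2 * X / (32 * q) + 16 * q * β * I))) =
        16 * q * I + T ^ 2 * X / 2 + 256 * q ^ 2 * β * I := by
      field_simp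
      ring
    linarith
  constructor
  · have e1 : (32 * q + 512 * q ^ 2 * β) * I ≤ q * constκ α β γ₀ * I := by
      refine mul_le_mul_of_nonneg_right ?_ hI
      rw [hκ, haq]
      -- Here `κ = 32(2a + 1 + 2s) + 128βq` with `a = 16βq`, which exceeds the required `32 + 512βq`
      -- with room to spare.
      nlinarith [mul_pos hq hs, mul_pos (mul_pos hq hq) hβ]
    rw [div_mul_eq_mul_div, le_div_iff₀ (by positivity)]
    linarith
  -- A second choice of `δ`: by `hX1`, `β X T² ≤ 2(a + a²) I ≤ 2s² I`, so both parts of the work are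
  -- at most `s I`. Thus `T E₀ ≤ (1 + 2s) I ≤ I / M`.
  · have e0 := h₀ (T / s) (by positivity)
    have e1 : T * (T / s * β / 2 * X + (T / s)⁻¹ * I) = β * (X * T ^ 2) / (2 * s) + s * I := by
      field_simp
    have e2 : β * (X * T ^ 2) / (2 * s) ≤ s * I := by
      rw [div_le_iff₀ (by positivity)]
      have e3 := mul_le_mul_of_nonneg_left hX1 hβ.le
      have e4 : β * ((32 * q + 512 * q ^ 2 * β) * I) = 2 * (a + a ^ 2) * I := by
        rw [haq]
        ring
      have e5 : s * I * (2 * s) = 2 * (a ^ 2 + a + b) * I := by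
        rw [← hsq]
        ring
      rw [e5]
      have e6 : 0 ≤ b * I := by positivity
      linarith
    rw [e1] at e0
    rw [div_mul_eq_mul_div, le_div_iff₀ hT]
    have e7 : 0 ≤ a * I := by positivity
    linarith

end ConstantBounds

/-! ### The cascade system -/

variable {𝕜 H G : Type*} [RCLike 𝕜] [NormedAddCommGroup H] [InnerProductSpace 𝕜 H]
  [CompleteSpace H] [NormedSpace ℝ H] [IsScalarTower ℝ 𝕜 H]
  [NormedAddCommGroup G] [InnerProductSpace 𝕜 G] [CompleteSpace G]
  [NormedSpace ℝ G] [IsScalarTower ℝ 𝕜 G] {A : H →ₗ.[𝕜] H}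

theorem IsAdmissibleGenerator.exists_free_solution_energy_pos [Nontrivial H]
    (hA : IsAdmissibleGenerator A) (T : ℝ) :
    ∃ w v : ℝ → H, IsSolution A T (fun _ => 0) w v ∧ 0 < energy A 1 (w 0) (v 0) := by
  obtain ⟨x, hx⟩ := exists_ne (0 : H)
  obtain ⟨w, v, h, hw, hv⟩ := hA.exists_free_solution T (w₀ := 0)
    (by simp [MemH, normSq]) x
  refine ⟨w, v, h, ?_⟩
  have := hA.norm_sq_le_energy (w 0) (v 0)
  rw [hv] at this ⊢
  have hx' : 0 < ‖x‖ ^ 2 := by positivity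
  linarith

/-- If `C = 0`, coercivity forces `Π = 0`, which cannot observe the nonzero free solution that
exists because `H` is nontrivial. -/
theorem IsCoupling.norm_pos_of_uniform [Nontrivial H] (hA : IsAdmissibleGenerator A)
    {C Pi : H →L[𝕜] H} {α β τ γ₀ : ℝ} (hC : IsCoupling A C β) (hP : IsPartiallyCoercive C Pi α)
    (hτ : 0 < τ) (hobs : UniformlyObservesVelocity A Pi τ γ₀) : 0 < β := by
  have hβ : 0 ≤ β := hC.norm_eq ▸ norm_nonneg C
  refine hβ.lt_of_ne fun h0 => ?_
  have hC0 : C = 0 := norm_eq_zero.mp (hC.norm_eq.trans h0.symm)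
  have hPi : ∀ x, ‖Pi x‖ ^ 2 = 0 := fun x => by
    have := hP.2 x
    rw [hC0] at this
    simp only [zero_apply, inner_zero_left, map_zero] at this
    exact le_antisymm (nonpos_of_mul_nonpos_right this hP.1) (by positivity)
  obtain ⟨w, v, h, hpos⟩ := hA.exists_free_solution_energy_pos (τ + 1)
  have := hobs (τ + 1) (by linarith) w v h
  simp only [hPi, intervalIntegral.integral_zero, mul_zero] at this
  nlinarith [mul_pos (show 0 < τ + 1 by linarith) hpos]

/-- The coupling term is controlled by the energy of the second component at both ends. -/
theorem IsCascadeSolution.coupling_le (hA : IsAdmissibleGenerator A) {C Pi : H →L[𝕜] H}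
    {α γ₀ τ T : ℝ} (hP : IsPartiallyCoercive C Pi α) (hγ : 0 < γ₀) (hT : 0 < T) (hτT : τ < T)
    (hobs : UniformlyObservesVelocity A Pi τ γ₀) {u₁ u₂ v₁ v₂ : ℝ → H}
    (h : IsCascadeSolution A C T u₁ u₂ v₁ v₂) :
    T * energy A 0 (u₁ 0) (v₁ 0) ≤
        γ₀ / α * (∫ t in (0 : ℝ)..T, RCLike.re ⟪C (u₁ t), u₁ t⟫_𝕜) ∧
      (∫ t in (0 : ℝ)..T, RCLike.re ⟪C (u₁ t), u₁ t⟫_𝕜) ≤ 8 * (γ₀ / α) / T *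
        (energy A 1 (u₂ 0) (v₂ 0) + energy A 1 (u₂ T) (v₂ T)) := by
  have hα := hP.1
  have h0T : (0 : ℝ) ∈ Set.Icc 0 T := ⟨le_rfl, hT.le⟩
  have hTT : T ∈ Set.Icc 0 T := ⟨hT.le, le_rfl⟩
  obtain ⟨z, hz, hze⟩ := h.first.exists_antiderivative hA
  have hcu := h.first.continuousOn_w
  have hcf : ContinuousOn (fun t => -C (u₁ t)) (Set.Icc 0 T) := by fun_prop
  have hf := hcf.memL2
  have hXi : IntervalIntegrable (fun t => RCLike.re ⟪C (u₁ t), u₁ t⟫_𝕜) volume 0 T :=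
    intervalIntegrable_re_inner
      ((show ContinuousOn (fun t => C (u₁ t)) (Set.Icc 0 T) by fun_prop).memL2.intervalIntegrable
        h0T hTT) (hcu.mono (Set.uIcc_subset_Icc h0T hTT))
  set X := ∫ t in (0 : ℝ)..T, RCLike.re ⟪C (u₁ t), u₁ t⟫_𝕜
  -- The velocity of the lifted solution `z` is `u₁` itself, so observing it through `Π` meets the
  -- coercivity of `C`.
  have e1 : T * energy A 1 (z 0) (u₁ 0) ≤ γ₀ / α * X := by
    refine (hobs T hτT z u₁ hz).trans ?_
    rw [div_mul_eq_mul_div, le_div_iff₀ hα, mul_assoc]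
    refine mul_le_mul_of_nonneg_left ?_ hγ.le
    rw [mul_comm, ← intervalIntegral.integral_const_mul]
    refine intervalIntegral.integral_mono_on hT.le ?_ hXi fun t _ => hP.2 (u₁ t)
    have : ContinuousOn (fun t => α * ‖Pi (u₁ t)‖ ^ 2) (Set.Icc 0 T) := by fun_prop
    exact (this.mono (Set.uIcc_subset_Icc h0T hTT)).intervalIntegrable
  refine ⟨hze 0 ▸ e1, ?_⟩
  have hsum := IsSolution.add hA hf continuousOn_const.memL2 h.second hz
  have hsumf : MemL2 T (fun t => -C (u₁ t) + 0) := by simpa using hf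
  have i1 := hsum.energy_eq hA hsumf hTT
  have i2 := h.second.energy_eq hA hf hTT
  have i3 := hz.energy_const hA hTT
  -- Both solutions have source `-C u₁` and their velocities differ by `u₁`, so the works differ by
  -- exactly `-X`.
  have hX : ∫ t in (0 : ℝ)..T, RCLike.re ⟪-C (u₁ t) + 0, v₂ t + u₁ t⟫_𝕜 =
      (∫ t in (0 : ℝ)..T, RCLike.re ⟪-C (u₁ t), v₂ t⟫_𝕜) - X := by
    rw [← intervalIntegral.integral_sub (intervalIntegrable_re_inner
      (hf.intervalIntegrable h0T hTT)
      (h.second.continuous_v.mono (Set.uIcc_subset_Icc h0T hTT))) hXi]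
    refine intervalIntegral.integral_congr fun t _ => ?_
    simp only [add_zero, inner_add_right, map_add, inner_neg_left, map_neg]
    ring
  rw [hX] at i1
  -- Comparing the two identities gives `X ≤ θ(E₀ + E₁) + 2θ⁻¹ e₁(z)`, where `e₁(z)` is conserved.
  -- This `θ` makes the last term at most `X / 2`.
  have hθ : 0 < 4 * (γ₀ / α) / T := by positivity
  have b1 := hA.energy_add_le hθ (h.second.mem_H1 0 h0T) (hz.mem_H1 0 h0T) (v₂ 0) (u₁ 0)
  have b2 := hA.le_energy_add hθ (h.second.mem_H1 T hTT) (hz.mem_H1 T hTT) (v₂ T) (u₁ T)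
  set θ := 4 * (γ₀ / α) / T
  have b3 : θ⁻¹ * energy A 1 (z 0) (u₁ 0) ≤ X / 4 := by
    have h1 : θ⁻¹ * energy A 1 (z 0) (u₁ 0) =
        (4 * (γ₀ / α))⁻¹ * (T * energy A 1 (z 0) (u₁ 0)) := by
      simp only [θ, inv_div]
      ring
    have h2 : (4 * (γ₀ / α))⁻¹ * (γ₀ / α * X) = X / 4 := by field_simp
    rw [h1, ← h2]
    gcongr
  rw [i3] at b2
  have b4 : 8 * (γ₀ / α) / T = 2 * θ := by simp only [θ]; ring
  rw [b4]
  linarith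

/-- The cascade estimates with the explicit constants. -/
theorem cascadeEstimates_of_uniform (hA : IsAdmissibleGenerator A) {C Pi : H →L[𝕜] H}
    {Bs : (A.domain × H) →ₗ[𝕜] G} (hB : IsAdmissible A Bs) {α β τ η₀ α₀ γ₀ T : ℝ}
    (hC : IsCoupling A C β) (hβ : 0 < β) (hP : IsPartiallyCoercive C Pi α) (hτ : 0 < τ)
    (hα₀ : 0 < α₀) (hγ : 0 < γ₀) (hobs : UniformlyObserves A Bs τ η₀ α₀)
    (hobs' : UniformlyObservesVelocity A Pi τ γ₀) (hT : time₃ τ α β γ₀ α₀ < T) :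
    CascadeEstimates A C Bs T (d₁ α β γ₀ α₀ η₀ T) (d₂ α β γ₀ α₀ η₀ T)
      (k₂ α β γ₀ α₀ η₀ T) (r₂ α β γ₀ α₀ η₀ T) := by
  have hα := hP.1
  have hτT : τ < T := (le_max_left _ _).trans_lt hT
  have hT1 : time₁ α β γ₀ α₀ < T := ((le_max_left _ _).trans (le_max_right _ _)).trans_lt hT
  have hT2 : time₂ α β γ₀ α₀ < T := ((le_max_right _ _).trans (le_max_right _ _)).trans_lt hT
  have hT0 : 0 < T := hτ.trans hτT
  have h0T : (0 : ℝ) ∈ Set.Icc 0 T := ⟨le_rfl, hT0.le⟩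
  have hTT : T ∈ Set.Icc 0 T := ⟨hT0.le, le_rfl⟩
  have hM := constM_pos hα hβ hγ
  have hκ := constκ_pos hα hβ hγ
  intro u₁ u₂ v₁ v₂ h
  have hcu := h.first.continuousOn_w
  have hcf : ContinuousOn (fun t => -C (u₁ t)) (Set.Icc 0 T) := by fun_prop
  have hf := hcf.memL2
  obtain ⟨-, hadm⟩ := hB
  obtain ⟨c, -, hadm⟩ := hadm T hT0
  obtain ⟨y, hy, -⟩ := hadm _ _ _ hf h.second
  have hXi : IntervalIntegrable (fun t => RCLike.re ⟪C (u₁ t), u₁ t⟫_𝕜) volume 0 T :=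
    intervalIntegrable_re_inner
      ((show ContinuousOn (fun t => C (u₁ t)) (Set.Icc 0 T) by fun_prop).memL2.intervalIntegrable
        h0T hTT) (hcu.mono (Set.uIcc_subset_Icc h0T hTT))
  have hEi := h.second.intervalIntegrable_energy hA hf h0T hTT
  have huo := hobs T hτT _ _ _ hf h.second y hy
  obtain ⟨hZ, hX⟩ := h.coupling_le hA hP hγ hT0 hτT hobs'
  refine ⟨y, hy, ?_⟩
  set X := ∫ t in (0 : ℝ)..T, RCLike.re ⟪C (u₁ t), u₁ t⟫_𝕜 with hXdef
  set I := ∫ t in (0 : ℝ)..T, energy A 1 (u₂ t) (v₂ t) with hIdef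
  set Y := ∫ t in (0 : ℝ)..T, ‖y t‖ ^ 2
  have hI0 : 0 ≤ I := intervalIntegral.integral_nonneg hT0.le fun t _ => energy_nonneg _ _ _
  -- `δ` stays free because `coupling_bounds` uses it with two different values.
  have hE : ∀ t ∈ Set.Icc 0 T, ∀ δ > 0,
      T * energy A 1 (u₂ t) (v₂ t) ≤ I + T * (δ * β / 2 * X + δ⁻¹ * I) := by
    intro t ht δ hδ
    have hk : ∀ s ∈ Set.Icc 0 T, ‖-C (u₁ s)‖ * ‖v₂ s‖ ≤
        δ * β / 2 * RCLike.re ⟪C (u₁ s), u₁ s⟫_𝕜 + δ⁻¹ * energy A 1 (u₂ s) (v₂ s) := by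
      intro s _
      rw [norm_neg]
      have h1 := mul_le_mul_of_nonneg_left (hC.sq_le (u₁ s)) (show 0 ≤ δ / 2 by positivity)
      have h2 := mul_le_mul_of_nonneg_left (hA.norm_sq_le_energy (u₂ s) (v₂ s))
        (show 0 ≤ δ⁻¹ / 2 by positivity)
      have h3 : δ / 2 * ‖C (u₁ s)‖ ^ 2 + δ⁻¹ / 2 * ‖v₂ s‖ ^ 2 - ‖C (u₁ s)‖ * ‖v₂ s‖ =
          δ⁻¹ / 2 * (δ * ‖C (u₁ s)‖ - ‖v₂ s‖) ^ 2 := by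
        field_simp
        ring
      have h4 : 0 ≤ δ⁻¹ / 2 * (δ * ‖C (u₁ s)‖ - ‖v₂ s‖) ^ 2 := by positivity
      linarith
    have := h.second.mul_energy_le hA hf ((hXi.const_mul _).add (hEi.const_mul _)) hk ht
    rwa [intervalIntegral.integral_add (hXi.const_mul _) (hEi.const_mul _),
      intervalIntegral.integral_const_mul, intervalIntegral.integral_const_mul, ← hXdef,
      ← hIdef] at this
  obtain ⟨hX', hE0⟩ := coupling_bounds hα hβ hγ hT0 hI0 hX (hE 0 h0T) (hE T hTT)
  have hF : ∫ t in (0 : ℝ)..T, ‖-C (u₁ t)‖ ^ 2 ≤ β * X := by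
    rw [hXdef, ← intervalIntegral.integral_const_mul]
    refine intervalIntegral.integral_mono_on hT0.le (hf.intervalIntegrable_norm_sq h0T hTT)
      (hXi.const_mul _) fun t _ => ?_
    rw [norm_neg]
    exact hC.sq_le _
  have hden : 0 < T ^ 2 - time₂ α β γ₀ α₀ ^ 2 := by
    have := time₂_nonneg (α := α) (β := β) (γ₀ := γ₀) (α₀ := α₀)
    nlinarith
  have hIY : I ≤ k₂ α β γ₀ α₀ η₀ T * Y := by
    have h1 : α₀ * (∫ t in (0 : ℝ)..T, ‖-C (u₁ t)‖ ^ 2) ≤ α₀ * (β * X) := by gcongr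
    have h2 : α₀ * (β * X) ≤ α₀ * (β * (γ₀ / α * constκ α β γ₀ / T ^ 2 * I)) := by gcongr
    have h3 : α₀ * (β * (γ₀ / α * constκ α β γ₀ / T ^ 2 * I)) * (2 * T ^ 2) =
        (time₁ α β γ₀ α₀ ^ 2 + time₂ α β γ₀ α₀ ^ 2) * I := by
      rw [time_sq_add hα hβ hγ hα₀]
      field_simp
    -- Absorption: `T > T₁` uses up half of `2T² I`, and `T > T₂` keeps the remaining factor `T² -
    -- T₂²` positive.
    have h4 : time₁ α β γ₀ α₀ ^ 2 * I ≤ T ^ 2 * I := by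
      have := time₁_nonneg hα hβ hγ (α₀ := α₀)
      gcongr
    have h5 : I ≤ η₀ * Y + α₀ * (β * (γ₀ / α * constκ α β γ₀ / T ^ 2 * I)) := by linarith
    have h6 := mul_le_mul_of_nonneg_right h5 (show 0 ≤ 2 * T ^ 2 by positivity)
    rw [add_mul, h3] at h6
    unfold k₂
    rw [div_mul_eq_mul_div, le_div_iff₀ hden]
    linarith
  have hXY : X ≤ r₂ α β γ₀ α₀ η₀ T * Y := by
    rw [r₂_eq hT0.ne', mul_assoc]
    exact hX'.trans (by gcongr)
  refine ⟨?_, ?_, hIY, hXY⟩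
  · rw [d₁_eq, mul_assoc]
    have h1 : energy A 0 (u₁ 0) (v₁ 0) ≤ γ₀ / α / T * X := by
      rw [div_mul_eq_mul_div, le_div_iff₀ hT0]
      linarith
    exact h1.trans (by gcongr)
  · rw [d₂_eq hT0.ne', mul_assoc]
    exact hE0.trans (by gcongr)

theorem cascadeObservability [Nontrivial H] (hA : IsAdmissibleGenerator A) {C Pi : H →L[𝕜] H}
    {Bs : (A.domain × H) →ₗ[𝕜] G} (hB : IsAdmissible A Bs) {α β T₀ : ℝ} (hC : IsCoupling A C β)
    (hT₀ : 0 < T₀) (hobs : Observes A Bs T₀) (hP : IsPartiallyCoercive C Pi α)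
    (hobs' : ObservesVelocity A Pi T₀) : CascadeObservability A C Pi Bs α β T₀ := by
  refine ⟨fun τ hτ => ?_, fun τ hτ η₀ hη α₀ hα₀ γ₀ hγ h1 h2 => ?_⟩
  · obtain ⟨η₀, hη, α₀, hα₀, h1⟩ := exists_uniformlyObserves hA hB hT₀ hobs hτ
    obtain ⟨γ₀, hγ, h2⟩ := exists_uniformlyObservesVelocity hA hT₀ hobs' hτ
    exact ⟨η₀, hη, α₀, hα₀, γ₀, hγ, h1, h2⟩
  have hα := hP.1
  have hβ := hC.norm_pos_of_uniform hA hP hτ h2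
  have hM := constM_pos hα hβ hγ
  have hκ := constκ_pos hα hβ hγ
  refine ⟨constK_pos hα hβ hγ hη, fun T hT => ?_⟩
  have hT0 : 0 < T := hτ.trans ((le_max_left _ _).trans_lt hT)
  have hT2 : time₂ α β γ₀ α₀ < T := ((le_max_right _ _).trans (le_max_right _ _)).trans_lt hT
  have hden : 0 < T ^ 2 - time₂ α β γ₀ α₀ ^ 2 := by
    have := time₂_nonneg (α := α) (β := β) (γ₀ := γ₀) (α₀ := α₀)
    nlinarith
  refine ⟨cascadeEstimates_of_uniform hA hB hC hβ hP hτ hα₀ hγ h1 h2 hT, ?_, ?_,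
    constants_le hα hβ hγ hη hT0⟩
  · unfold d₁
    positivity
  · unfold d₂
    positivity

/-- The inequality is `|C w|² ≤ β Re⟪C w, w⟫` divided by `β`. Its content is `β > 0`: the zero
operator observes nothing. -/
theorem IsCoupling.isPartiallyCoercive_self [Nontrivial H] (hA : IsAdmissibleGenerator A)
    {C : H →L[𝕜] H} {β T₀ : ℝ} (hC : IsCoupling A C β) (hobs : ObservesVelocity A C T₀) :
    IsPartiallyCoercive C C β⁻¹ := by
  have hβ : 0 < β := by
    refine (hC.norm_eq ▸ norm_nonneg C : 0 ≤ β).lt_of_ne fun h0 => ?_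
    have hC0 : C = 0 := norm_eq_zero.mp (hC.norm_eq.trans h0.symm)
    obtain ⟨c, hc, h⟩ := hobs (T₀ + 1) (by linarith)
    obtain ⟨w, v, hs, hpos⟩ := hA.exists_free_solution_energy_pos (T₀ + 1)
    have := h w v hs
    simp only [hC0, zero_apply, norm_zero, ne_eq, OfNat.ofNat_ne_zero,
      not_false_eq_true, zero_pow, intervalIntegral.integral_zero] at this
    nlinarith [mul_pos hc hpos]
  refine ⟨inv_pos.mpr hβ, fun w => ?_⟩
  rw [inv_mul_le_iff₀ hβ]
  exact hC.sq_le w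

end

end Cascade

end

theorem theorem2p7 {𝕜 H G : Type*} [RCLike 𝕜]
    [NormedAddCommGroup H] [InnerProductSpace 𝕜 H] [CompleteSpace H] [Nontrivial H]
    [NormedSpace ℝ H] [IsScalarTower ℝ 𝕜 H]
    [NormedAddCommGroup G] [InnerProductSpace 𝕜 G] [CompleteSpace G]
    [NormedSpace ℝ G] [IsScalarTower ℝ 𝕜 G]
    (A : H →ₗ.[𝕜] H) (hA : Cascade.IsAdmissibleGenerator A)
    (C : H →L[𝕜] H) (β : ℝ) (hC : Cascade.IsCoupling A C β)
    (Bs : (A.domain × H) →ₗ[𝕜] G) (hB : Cascade.IsAdmissible A Bs)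
    (T₀ : ℝ) (hT₀ : 0 < T₀) (hobs : Cascade.Observes A Bs T₀) :
    (∀ (Pi : H →L[𝕜] H) (α : ℝ), Cascade.IsPartiallyCoercive C Pi α →
      Cascade.ObservesVelocity A Pi T₀ →
      Cascade.CascadeObservability A C Pi Bs α β T₀) ∧
    (Cascade.ObservesVelocity A C T₀ →
      Cascade.IsPartiallyCoercive C C β⁻¹ ∧
      Cascade.CascadeObservability A C C Bs β⁻¹ β T₀) := by
  refine ⟨fun Pi α hP h => Cascade.cascadeObservability hA hB hC hT₀ hobs hP h, fun h => ?_⟩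
  have hP := hC.isPartiallyCoercive_self hA h
  exact ⟨hP, Cascade.cascadeObservability hA hB hC hT₀ hobs hP h⟩
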